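/- Let $c\ge 2$, let $N$ be an infinitely generated free nilpotent group of nilpotency class $c$, and let $\Gamma=\mathrm{Aut}(N)$. For $x\in N$ let $\tau_x\in\Gamma$ be the conjugation $z\mapsto xzx^{-1}$ and let $\Gamma_{(x)}=\{\sigma\in\Gamma:\sigma(x)=x\}$. An element of $N$ is \emph{primitive} if it belongs to some basis of $N$. A pair $(\tau,\Sigma)$ with $\tau\in\Gamma$ and $\Sigma\subseteq\Gamma$ is a \emph{primitive pair} if $\tau$ is conjugation by a primitive element of $N$, $\Sigma$ is the stabilizer $\Gamma_{(z)}$ of a primitive element $z$ of $N$, and every element of $\Sigma$ commutes with $\tau$. (1) For every primitive pair $(\tau,\Sigma)$ there is exactly one element $x=p(\tau,\Sigma)$ of $N$ such that $\tau_x=\tau$ and $x$ is fixed by every member of $\Sigma$. The map $x\mapsto(\tau_x,\Gamma_{(x)})$ is a bijection from the set of primitive elements of $N$ onto the set of primitive pairs, and $(\tau_{\sigma x},\Gamma_{(\sigma x)})=(\sigma\tau_x\sigma^{-1},\sigma\Gamma_{(x)}\sigma^{-1})$ for all $\sigma\in\Gamma$, $x\in N$. (2) There is a formula $\varphi$ of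 full second-order logic in the language of groups, whose free variables take as values an element and a subset $(\tau,\Sigma)$ of $\Gamma$ and two parameter pairs $(\tau_1,\Sigma_1)$, $(\tau_2,\Sigma_2)$ of the same kind, such that the following holds. Let $(\tau_1,\Sigma_1)$ and $(\tau_2,\Sigma_2)$ be primitive pairs which are independent, that is, $\tau_1\ne\tau_2$ and some basis of the group $\mathrm{Inn}(N)$ (a free nilpotent group of class $c-1$) contains both $\tau_1$ and $\tau_2$; let $x=p(\tau_1,\Sigma_1)$ and $y=p(\tau_2,\Sigma_2)$. Then $xy$ is primitive, $(\tau_1\tau_2,\Sigma_{1,2})$ with $\Sigma_{1,2}=\Gamma_{(xy)}$ is a primitive pair with $p(\tau_1\tau_2,\Sigma_{1,2})=xy$, and it is definable in the group $\Gamma$ with the parameters $(\tau_1,\Sigma_1),(\tau_2,\Sigma_2)$ by $\varphi$: for all $\tau\in\Gamma$ and $\Sigma\subseteq\Gamma$, $$\Gamma\models\varphi(\tau,\Sigma;\tau_1,\Sigma_1,\tau_2,\Sigma_2)\iff(\tau,\Sigma)=(\tau_1\tau_2,\Sigma_{1,2}).$$ -/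

import Mathlib

/-! ### Free nilpotent groups and their primitive elements -/

/-- `B` is a basis of `G` as a free nilpotent group of class `k`: the homomorphism from the free
group on `B` that extends the inclusion induces an isomorphism `F(B) / γ_{k+1}(F(B)) ≅ G`.
(Mathlib numbers the lower central series from `0`, so `γ_{k+1}` is its `k`-th term.) -/
def IsFreeNilpotentBasis {G : Type*} [Group G] (k : ℕ) (B : Set G) : Prop :=
  Function.Surjective (FreeGroup.lift (fun b : B => (b : G))) ∧
    (FreeGroup.lift (fun b : B => (b : G))).ker = (⊤ : Subgroup (FreeGroup B)).lowerCentralSeries k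

/-- `G` is an infinitely generated free nilpotent group of class `k`. -/
def IsInfinitelyGeneratedFreeNilpotent (k : ℕ) (G : Type*) [Group G] : Prop :=
  ∃ B : Set G, B.Infinite ∧ IsFreeNilpotentBasis k B

/-- A primitive element is a member of some basis. -/
def IsPrimitiveElement {G : Type*} [Group G] (k : ℕ) (x : G) : Prop :=
  ∃ B : Set G, IsFreeNilpotentBasis k B ∧ x ∈ B

/-! ### Primitive pairs

`MulAut N` is the group `Aut N` with composition as multiplication, and `MulAut.conj x` is the
conjugation `z ↦ x * z * x⁻¹`. A pair `(τ, S)` consists of an element and a subset of `Aut N`. -/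

/-- The stabilizer of `x` in `Aut N`, as a subset of `Aut N`. -/
def autStabilizer {N : Type*} [Group N] (x : N) : Set (MulAut N) :=
  {σ | σ x = x}

/-- The pair `(τ_x, Γ_(x))`. -/
def pairOf {N : Type*} [Group N] (x : N) : MulAut N × Set (MulAut N) :=
  (MulAut.conj x, autStabilizer x)

/-- `(τ, S)` is a primitive pair: `τ` is conjugation by a primitive element, `S` is the stabilizer
of a primitive element (not assumed to be the same one), and every member of `S` commutes
with `τ`. -/
def IsPrimitivePair {N : Type*} [Group N] (c : ℕ) (P : MulAut N × Set (MulAut N)) : Prop :=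
  (∃ x : N, IsPrimitiveElement c x ∧ P.1 = MulAut.conj x) ∧
    (∃ z : N, IsPrimitiveElement c z ∧ P.2 = autStabilizer z) ∧
      ∀ σ ∈ P.2, σ * P.1 = P.1 * σ

/-- The pair `(τ, S)` determines the element `x`: conjugation by `x` is `τ`, and `x` is fixed by
every member of `S`. -/
def PairDetermines {N : Type*} [Group N] (P : MulAut N × Set (MulAut N)) (x : N) : Prop :=
  MulAut.conj x = P.1 ∧ ∀ σ ∈ P.2, σ x = x

/-- The conjugation action of `Aut N` on pairs. -/
def conjPair {N : Type*} [Group N] (σ : MulAut N) (P : MulAut N × Set (MulAut N)) :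
    MulAut N × Set (MulAut N) :=
  (σ * P.1 * σ⁻¹, (fun ρ => σ * ρ * σ⁻¹) '' P.2)

/-- `τ₁` and `τ₂` are two different members of one basis set of conjugations, that is, of one
basis of `Inn N` (a free nilpotent group of class `c - 1`). -/
def IndependentConjugations {N : Type*} [Group N] (c : ℕ) (τ₁ τ₂ : MulAut N) : Prop :=
  τ₁ ≠ τ₂ ∧ ∃ X : Set (MulAut.conj : N →* MulAut N).range,
    IsFreeNilpotentBasis (c - 1) X ∧ τ₁ ∈ Subtype.val '' X ∧ τ₂ ∈ Subtype.val '' X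

/-! ### Full second-order logic in the language of groups -/

/-- Terms of the language of groups, with individual variables indexed by `ℕ`. -/
inductive GroupTerm : Type
  | var (i : ℕ) : GroupTerm
  | one : GroupTerm
  | mul (s t : GroupTerm) : GroupTerm
  | inv (t : GroupTerm) : GroupTerm

/-- Second-order formulas in the language of groups. For each arity `n` there are `n`-ary relation
variables, indexed by `ℕ`; the quantifiers bind individual and relation variables. The other
connectives and the existential quantifiers are the usual abbreviations. -/
inductive SOFormula : Type
  | eq (s t : GroupTerm) : SOFormula
  | rel (n k : ℕ) (ts : Fin n → GroupTerm) : SOFormula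
  | not (φ : SOFormula) : SOFormula
  | and (φ ψ : SOFormula) : SOFormula
  | all (i : ℕ) (φ : SOFormula) : SOFormula
  | allRel (n k : ℕ) (φ : SOFormula) : SOFormula

/-- An assignment of values in `G` to all individual variables and all relation variables. -/
structure SOAssignment (G : Type*) where
  /-- The value of the `i`-th individual variable. -/
  elem : ℕ → G
  /-- The value of the `k`-th relation variable of arity `n`. -/
  relation : (n : ℕ) → ℕ → Set (Fin n → G)

/-- Change the value of the `i`-th individual variable to `g`. -/
def SOAssignment.setElem {G : Type*} (a : SOAssignment G) (i : ℕ) (g : G) : SOAssignment G :=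
  ⟨Function.update a.elem i g, a.relation⟩

/-- Change the value of the `k`-th relation variable of arity `n` to `R`. -/
def SOAssignment.setRelation {G : Type*} (a : SOAssignment G) (n k : ℕ) (R : Set (Fin n → G)) :
    SOAssignment G :=
  ⟨a.elem, Function.update a.relation n (Function.update (a.relation n) k R)⟩

/-- The value of a term. -/
def GroupTerm.eval {G : Type*} [Group G] (a : SOAssignment G) : GroupTerm → G
  | .var i => a.elem i
  | .one => 1
  | .mul s t => s.eval a * t.eval a
  | .inv t => (t.eval a)⁻¹

/-- Truth of a formula in the group `G` under an assignment, with the full semantics: an `n`-ary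
relation quantifier ranges over all `n`-ary relations on `G`. -/
def SOFormula.Holds {G : Type*} [Group G] : SOFormula → SOAssignment G → Prop
  | .eq s t, a => s.eval a = t.eval a
  | .rel n k ts, a => (fun j => (ts j).eval a) ∈ a.relation n k
  | .not φ, a => ¬ φ.Holds a
  | .and φ ψ, a => φ.Holds a ∧ ψ.Holds a
  | .all i φ, a => ∀ g : G, φ.Holds (a.setElem i g)
  | .allRel n k φ, a => ∀ R : Set (Fin n → G), φ.Holds (a.setRelation n k R)

/-- In the assignment `a`, the `i`-th individual variable and the `i`-th unary relation variable
have as values the components of the pair `P`. -/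
def SOAssignment.HasPair {G : Type*} (a : SOAssignment G) (i : ℕ) (P : G × Set G) : Prop :=
  a.elem i = P.1 ∧ a.relation 1 i = {v | v 0 ∈ P.2}

/-- `φ` defines the pair `P` in `G` with the parameters `P₁, P₂`: if the variables with index `1`
and `2` are interpreted by `P₁` and `P₂`, then `φ` holds exactly when the variables with index `0`
are interpreted by `P`, whatever the values of all other variables are. -/
def SOFormula.DefinesPair {G : Type*} [Group G] (φ : SOFormula) (P P₁ P₂ : G × Set G) : Prop :=
  ∀ a : SOAssignment G, a.HasPair 1 P₁ → a.HasPair 2 P₂ → (φ.Holds a ↔ a.HasPair 0 P)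

/-!
Let `N` be free nilpotent of class `c ≥ 2` on an infinite basis, `Z` its centre.

*Pairs determine elements.* An element that is fixed, modulo `Z` or exactly, by the stabilizer of a
basis element `z` is, modulo `Z` or exactly, a power of `z`: an automorphism fixing `z` moves the
other basis elements that occur in it to new ones, and a surjective endomorphism then kills these
(`IsNilBasis.exists_mem_closure_of_fixed`; surjective endomorphisms preserve `Z`). A Heisenberg
quotient shows `Z ≤ [N, N]` (`IsNilBasis.center_le_lcs_one`), so for a primitive pair the power has
exponent `1` or `-1`, and no nontrivial power of `z` is central. Hence the primitive pairs are the
pairs `pairOf x` with `x` primitive, and `x` is unique.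

*Independent pairs.* Representatives of a basis of `Inn N` form a basis of `N`
(`IsNilBasis.of_conj`), so the elements `x`, `y` of an independent couple of pairs lie in a common
basis, and `x y` is primitive. Moreover `Z` is then the last nontrivial term of the lower central
series.

*Definability.* An equation `g x = h y` between images of primitive elements under automorphisms is
an equation between conjugated pairs, hence expressible in `Aut N`. The formula for
`(τ₁ τ₂, Γ_(xy))` says that the pair belongs to some primitive `z` with `τ_z = τ₁ τ₂`, so that
`z = x y t` with `t` central, that all automorphisms fixing `x` and `y` fix `z`, so that `t` is a
word in `x` and `y`, and that the operation `x ∗ y = z`, transported by automorphisms to all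
independent couples, is associative and satisfies `(x y x⁻¹) ∗ x = x ∗ y`. These identities make
`t = T (x, y)` a symmetric cocycle, whence `T (x², y²) = T (x, y)²`. But `t` is a product of
`c`-fold commutators, so `T (x², y²) = T (x, y) ^ 2 ^ c`. Therefore `t ^ (2 ^ c - 2) = 1`, and
`t = 1` because free nilpotent groups are torsion-free (`IsNilBasis.eq_mul_of_symm_of_assoc`).

*Torsion-freeness.* More generally, a free group whose generators carry positive weights is
torsion-free modulo each term of the smallest central filtration compatible with the weights
(`mem_weightSubgroup_of_pow_mem`). A generator `x₀` of least weight is eliminated: the quotient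
embeds in the semidirect product of `ℤ` with the corresponding quotient of the free group on
symbols `(y, n)` for the iterated commutators of the other generators `y` with `n` factors `x₀`.
After finitely many eliminations all weights are too large to matter.
-/

open scoped commutatorElement

/-! ### The lower central series -/

/-- The term `γ_{n+1}(G)` of the lower central series, numbered from `0`. -/
abbrev lcs (G : Type*) [Group G] (n : ℕ) : Subgroup G := (⊤ : Subgroup G).lowerCentralSeries n

section LowerCentralSeries

variable {G H F : Type*} [Group G] [Group H] [Group F]

theorem map_mem_lcs (f : G →* H) {n : ℕ} {g : G} (hg : g ∈ lcs G n) : f g ∈ lcs H n := by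
  have h : (lcs G n).map f ≤ lcs H n := by
    rw [Subgroup.map_lowerCentralSeries]
    exact Subgroup.lowerCentralSeries_mono n le_top
  exact h (Subgroup.mem_map_of_mem f hg)

theorem map_mem_lcs_iff (e : G ≃* H) {n : ℕ} {g : G} : e g ∈ lcs H n ↔ g ∈ lcs G n :=
  ⟨fun h => by simpa using map_mem_lcs e.symm.toMonoidHom h, map_mem_lcs e.toMonoidHom⟩

theorem lcs_quotient_eq_bot (n : ℕ) : lcs (G ⧸ lcs G n) n = ⊥ := by
  have h := Subgroup.map_lowerCentralSeries (⊤ : Subgroup G) (QuotientGroup.mk' (lcs G n)) n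
  rw [Subgroup.map_top_of_surjective _ (QuotientGroup.mk'_surjective _)] at h
  refine h.symm.trans ?_
  rw [Subgroup.map_eq_bot_iff, QuotientGroup.ker_mk']

theorem lcs_eq_bot_of_le {m n : ℕ} (hmn : m ≤ n) (h : lcs G m = ⊥) : lcs G n = ⊥ :=
  le_bot_iff.mp (h ▸ Subgroup.lowerCentralSeries_antitone _ hmn)

theorem lcs_le_center {n : ℕ} (h : lcs G (n + 1) = ⊥) : lcs G n ≤ Subgroup.center G :=
  Subgroup.commutator_top_right_eq_bot_iff_le_center.mp h

theorem lcs_eq_bot_of_commGroup {A : Type*} [CommGroup A] {n : ℕ} (hn : n ≠ 0) : lcs A n = ⊥ :=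
  lcs_eq_bot_of_le (Nat.one_le_iff_ne_zero.mpr hn)
    (Subgroup.commutator_top_right_eq_bot_iff_le_center.mpr
      fun g _ => Subgroup.mem_center_iff.mpr fun h => mul_comm h g)

theorem map_eq_one_of_mem_lcs_one {A : Type*} [CommGroup A] (f : G →* A) {g : G}
    (hg : g ∈ lcs G 1) : f g = 1 := by
  have := map_mem_lcs f hg
  rwa [lcs_eq_bot_of_commGroup one_ne_zero] at this

/-- The three subgroups lemma modulo a normal subgroup. -/
theorem commutator_commutator_le_of_rotate {A B C K : Subgroup G} [K.Normal]
    (h₁ : ⁅⁅B, C⁆, A⁆ ≤ K) (h₂ : ⁅⁅C, A⁆, B⁆ ≤ K) : ⁅⁅A, B⁆, C⁆ ≤ K := by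
  have key : ∀ D : Subgroup G, D ≤ K ↔ D.map (QuotientGroup.mk' K) = ⊥ := fun D => by
    rw [Subgroup.map_eq_bot_iff, QuotientGroup.ker_mk']
  rw [key, Subgroup.map_commutator, Subgroup.map_commutator] at *
  exact Subgroup.commutator_commutator_eq_bot_of_rotate h₁ h₂

theorem commutator_lcs_lcs_le (i j : ℕ) : ⁅lcs G i, lcs G j⁆ ≤ lcs G (i + j + 1) := by
  induction j generalizing i with
  | zero => exact le_rfl
  | succ j ih =>
    rw [Subgroup.commutator_comm]
    refine commutator_commutator_le_of_rotate (A := lcs G j) (B := ⊤) (C := lcs G i) ?_ ?_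
    · rw [Subgroup.commutator_comm ⊤]
      refine (ih (i + 1)).trans (le_of_eq ?_)
      congr 1
      omega
    · exact Subgroup.commutator_mono (ih i) le_rfl

theorem commutatorElement_mul_left_of_mem_center {a b c : G} (h : ⁅b, c⁆ ∈ Subgroup.center G) :
    ⁅a * b, c⁆ = ⁅a, c⁆ * ⁅b, c⁆ := by
  have h' := Subgroup.mem_center_iff.mp h
  rw [commutatorElement_mul_left_eq_conj_mul, h' a, mul_inv_cancel_right, h']

theorem commutatorElement_mul_right_of_mem_center {a b c : G} (h : ⁅a, c⁆ ∈ Subgroup.center G) :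
    ⁅a, b * c⁆ = ⁅a, b⁆ * ⁅a, c⁆ := by
  have h' := Subgroup.mem_center_iff.mp h
  rw [commutatorElement_mul_right_eq_mul_conj, mul_assoc _ b, h' b, ← mul_assoc,
    mul_inv_cancel_right]

theorem commutatorElement_eq_one_of_mem_center_left {a b : G} (h : a ∈ Subgroup.center G) :
    ⁅a, b⁆ = 1 := by
  rw [commutatorElement_eq_one_iff_mul_comm, Subgroup.mem_center_iff.mp h b]

theorem commutatorElement_eq_one_of_mem_center_right {a b : G} (h : b ∈ Subgroup.center G) :
    ⁅a, b⁆ = 1 := by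
  rw [commutatorElement_eq_one_iff_mul_comm, Subgroup.mem_center_iff.mp h a]

theorem commutatorElement_pow_left_of_mem_center {a c : G} (h : ⁅a, c⁆ ∈ Subgroup.center G)
    (k : ℕ) : ⁅a ^ k, c⁆ = ⁅a, c⁆ ^ k := by
  induction k with
  | zero => simp
  | succ k ih => rw [pow_succ, commutatorElement_mul_left_of_mem_center h, ih, pow_succ]

theorem commutatorElement_pow_right_of_mem_center {a c : G} (h : ⁅a, c⁆ ∈ Subgroup.center G)
    (k : ℕ) : ⁅a, c ^ k⁆ = ⁅a, c⁆ ^ k := by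
  induction k with
  | zero => simp
  | succ k ih => rw [pow_succ, commutatorElement_mul_right_of_mem_center h, ih, pow_succ]

theorem mem_of_mem_commutator {A B K : Subgroup G} (h : ⁅A, B⁆ ≤ K) {a b : G} (ha : a ∈ A)
    (hb : b ∈ B) : ⁅a, b⁆ ∈ K :=
  h (Subgroup.commutator_mem_commutator ha hb)

/-- If `φ` is the `m`-th power of `ψ` modulo commutators, then on `γ_{n+1}(F)`, whose elements
are products of `(n+1)`-fold commutators, it is the power of `ψ` with exponent `m ^ (n + 1)`
modulo `γ_{n+2}`. -/
theorem map_eq_pow_of_mem_lcs (m n : ℕ) (hG : lcs G (n + 1) = ⊥) (φ ψ : F →* G)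
    (h : ∀ g, (ψ g ^ m)⁻¹ * φ g ∈ lcs G 1) {g : F} (hg : g ∈ lcs F n) :
    φ g = ψ g ^ m ^ (n + 1) := by
  induction n generalizing G g with
  | zero =>
    have := h g
    rw [hG, Subgroup.mem_bot, inv_mul_eq_one] at this
    simpa using this.symm
  | succ n ih =>
    have hcen : lcs G (n + 1) ≤ Subgroup.center G := lcs_le_center hG
    induction hg using Subgroup.closure_induction with
    | one => simp
    | mul x y hx hy ihx ihy =>
      have hx' : ψ x ∈ Subgroup.center G := hcen (map_mem_lcs ψ hx)
      have hc : Commute (ψ x) (ψ y) := (Subgroup.mem_center_iff.mp hx' (ψ y)).symm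
      rw [map_mul, map_mul, ihx, ihy, hc.mul_pow]
    | inv x hx ihx => rw [map_inv, map_inv, ihx, inv_pow]
    | mem x hx =>
      obtain ⟨a, ha, b, -, rfl⟩ := hx
      set q := QuotientGroup.mk' (lcs G (n + 1))
      have hs := ih (lcs_quotient_eq_bot (n + 1)) (q.comp φ) (q.comp ψ) (fun g => by
        simpa only [map_mul, map_inv, map_pow, MonoidHom.comp_apply] using
          map_mem_lcs q (h g)) ha
      have hs' : (ψ a ^ m ^ (n + 1))⁻¹ * φ a ∈ lcs G (n + 1) := by
        rw [← QuotientGroup.ker_mk' (lcs G (n + 1)), MonoidHom.mem_ker, map_mul, map_inv, map_pow]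
        exact inv_mul_eq_one.mpr hs.symm
      obtain ⟨s, hs, hφa⟩ : ∃ s ∈ lcs G (n + 1), φ a = ψ a ^ m ^ (n + 1) * s :=
        ⟨_, hs', by group⟩
      obtain ⟨r, hr, hφb⟩ : ∃ r ∈ lcs G 1, φ b = ψ b ^ m * r := ⟨_, h b, by group⟩
      have hψa : ψ a ∈ lcs G n := map_mem_lcs ψ ha
      have hab : ∀ d : G, ⁅ψ a, d⁆ ∈ Subgroup.center G := fun d =>
        hcen (Subgroup.commutator_mem_commutator hψa (Subgroup.mem_top d))
      have har : ⁅ψ a, r⁆ = 1 := by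
        have := mem_of_mem_commutator (commutator_lcs_lcs_le n 1) hψa hr
        rwa [hG, Subgroup.mem_bot] at this
      have hsd : ∀ d : G, ⁅s, d⁆ = 1 := fun d =>
        commutatorElement_eq_one_of_mem_center_left (hcen hs)
      rw [map_commutatorElement, map_commutatorElement, hφa, hφb,
        commutatorElement_mul_left_of_mem_center (by rw [hsd]; exact one_mem _), hsd, mul_one,
        commutatorElement_pow_left_of_mem_center (hab _),
        commutatorElement_mul_right_of_mem_center (hab _), har, mul_one,
        commutatorElement_pow_right_of_mem_center (hab _), ← pow_mul, ← pow_succ']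

/-- For a free group the assumption of `map_eq_pow_of_mem_lcs` need only be checked on
generators. -/
theorem inv_pow_mul_mem_lcs_one {X : Type*} (m : ℕ) (φ ψ : FreeGroup X →* G)
    (h : ∀ x, (ψ (.of x) ^ m)⁻¹ * φ (.of x) ∈ lcs G 1) (g : FreeGroup X) :
    (ψ g ^ m)⁻¹ * φ g ∈ lcs G 1 := by
  have key : ∀ a b : G, (b ^ m)⁻¹ * a ∈ lcs G 1 ↔
      Abelianization.of a = (powMonoidHom m : Abelianization G →* _) (Abelianization.of b) := by
    intro a b
    rw [show lcs G 1 = commutator G from rfl, ← Abelianization.ker_of, MonoidHom.mem_ker, map_mul,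
      map_inv, map_pow, inv_mul_eq_one, powMonoidHom_apply, eq_comm]
  have := FreeGroup.ext_hom (f := Abelianization.of.comp φ)
    (g := (powMonoidHom m).comp (Abelianization.of.comp ψ)) fun x => (key _ _).mp (h x)
  exact (key _ _).mpr (DFunLike.congr_fun this g)

end LowerCentralSeries

/-! ### Central filtrations -/

section Filtration

/-- A central filtration of `G`, indexed so that `K 0 = K 1 = ⊤`. -/
structure IsCentralFiltration {G : Type*} [Group G] (K : ℕ → Subgroup G) : Prop where
  antitone : Antitone K
  one_eq_top : K 1 = ⊤
  commutator_mem : ∀ {i j : ℕ} {a b : G}, a ∈ K i → b ∈ K j → ⁅a, b⁆ ∈ K (i + j)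

namespace IsCentralFiltration

variable {G H : Type*} [Group G] [Group H] {K : ℕ → Subgroup G} (hK : IsCentralFiltration K)
include hK

theorem mem_one (g : G) : g ∈ K 1 := hK.one_eq_top ▸ Subgroup.mem_top g

theorem mem_of_le {m n : ℕ} (h : m ≤ n) {g : G} (hg : g ∈ K n) : g ∈ K m := hK.antitone h hg

theorem conj_mem {m : ℕ} {g : G} (hg : g ∈ K m) (h : G) : h * g * h⁻¹ ∈ K m := by
  have h1 : ⁅h, g⁆ ∈ K m := hK.mem_of_le (by omega) (hK.commutator_mem (hK.mem_one h) hg)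
  have h2 : h * g * h⁻¹ = ⁅h, g⁆ * g := by rw [commutatorElement_def]; group
  exact h2 ▸ mul_mem h1 hg

theorem conj_mem' {m : ℕ} {g : G} (hg : g ∈ K m) (h : G) : h⁻¹ * g * h ∈ K m := by
  simpa using hK.conj_mem hg h⁻¹

theorem map_of_surjective (f : G →* H) (hf : Function.Surjective f) :
    IsCentralFiltration fun m => (K m).map f where
  antitone _ _ h := Subgroup.map_mono (hK.antitone h)
  one_eq_top := by rw [hK.one_eq_top, Subgroup.map_top_of_surjective f hf]
  commutator_mem := by
    rintro i j _ _ ⟨a, ha, rfl⟩ ⟨b, hb, rfl⟩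
    exact ⟨⁅a, b⁆, hK.commutator_mem ha hb, map_commutatorElement f a b⟩

end IsCentralFiltration

theorem isCentralFiltration_lcs (G : Type*) [Group G] :
    IsCentralFiltration fun m => lcs G (m - 1) where
  antitone _ _ h := Subgroup.lowerCentralSeries_antitone _ (Nat.sub_le_sub_right h 1)
  one_eq_top := rfl
  commutator_mem ha hb :=
    Subgroup.lowerCentralSeries_antitone _ (by omega)
      (mem_of_mem_commutator (commutator_lcs_lcs_le _ _) ha hb)

/-- `φ` moves each term of the filtration by elements that lie `a` steps deeper. -/
def IsShift {G : Type*} [Group G] (K : ℕ → Subgroup G) (a : ℕ) (φ : G →* G) : Prop :=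
  ∀ m, ∀ g ∈ K m, φ g * g⁻¹ ∈ K (m + a)

namespace IsShift

variable {G : Type*} [Group G] {K : ℕ → Subgroup G} (hK : IsCentralFiltration K)
  {a c : ℕ} {φ ψ : G →* G}

include hK

theorem map_mem (hφ : IsShift K a φ) {m : ℕ} {g : G} (hg : g ∈ K m) : φ g ∈ K m := by
  simpa using mul_mem (hK.mem_of_le (Nat.le_add_right m a) (hφ m g hg)) hg

theorem comp (hφ : IsShift K a φ) (hψ : IsShift K a ψ) : IsShift K a (φ.comp ψ) := by
  intro m g hg
  have := mul_mem (hφ m _ (hψ.map_mem hK hg)) (hψ m g hg)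
  simpa using this

theorem injective (ha : 0 < a) (hc : K c = ⊥) (hφ : IsShift K a φ) : Function.Injective φ := by
  rw [injective_iff_map_eq_one]
  intro g hg
  have h : ∀ m, g ∈ K m := by
    intro m
    induction m with
    | zero => exact hK.mem_of_le zero_le_one (hK.mem_one g)
    | succ m ih =>
      have := hφ m g ih
      rw [hg, one_mul, inv_mem_iff] at this
      exact hK.mem_of_le (by omega) this
  exact (Subgroup.mem_bot).mp (hc ▸ h c)

/-- If the filtration terminates, a shift maps each of its terms onto itself. -/
theorem exists_map_eq (ha : 0 < a) (hc : K c = ⊥) (hφ : IsShift K a φ) (m : ℕ) (g : G)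
    (hg : g ∈ K m) : ∃ h ∈ K m, φ h = g := by
  by_cases hm : c ≤ m
  · have : g = 1 := by
      have := hK.mem_of_le hm hg
      rwa [hc, Subgroup.mem_bot] at this
    exact ⟨1, one_mem _, by simp [this]⟩
  · obtain ⟨h, hh, he⟩ := exists_map_eq ha hc hφ (m + 1) (φ g * g⁻¹)
      (hK.mem_of_le (by omega) (hφ m g hg))
    refine ⟨h⁻¹ * g, mul_mem (inv_mem (hK.mem_of_le (by omega) hh)) hg, ?_⟩
    rw [map_mul, map_inv, he]
    group
termination_by c - m

theorem bijective (ha : 0 < a) (hc : K c = ⊥) (hφ : IsShift K a φ) : Function.Bijective φ :=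
  ⟨hφ.injective hK ha hc, fun g =>
    let ⟨h, _, e⟩ := hφ.exists_map_eq hK ha hc 1 g (hK.mem_one g); ⟨h, e⟩⟩

theorem symm (ha : 0 < a) (hc : K c = ⊥) {β : MulAut G} (hβ : IsShift K a β.toMonoidHom) :
    IsShift K a (β⁻¹ : MulAut G).toMonoidHom := by
  intro m g hg
  obtain ⟨h, hh, rfl⟩ := hβ.exists_map_eq hK ha hc m g hg
  have := inv_mem (hβ m h hh)
  simpa using this

theorem zpow (ha : 0 < a) (hc : K c = ⊥) {β : MulAut G} (hβ : IsShift K a β.toMonoidHom) (k : ℤ) :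
    IsShift K a (β ^ k : MulAut G).toMonoidHom := by
  induction k with
  | zero => intro m g hg; simp
  | succ n ih =>
    rw [zpow_add_one]
    exact comp hK ih hβ
  | pred n ih =>
    rw [zpow_sub_one]
    exact comp hK ih (symm hK ha hc hβ)

end IsShift

/-- The filtration of `G ⋊ ℤ` in which the generator of `ℤ` has weight `a`. -/
def semidirectFiltration {G : Type*} [Group G] {K : ℕ → Subgroup G}
    (hK : IsCentralFiltration K) {a c : ℕ} (ha : 0 < a) (hc : K c = ⊥) {β : MulAut G}
    (hβ : IsShift K a β.toMonoidHom) (m : ℕ) :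
    Subgroup (G ⋊[zpowersHom (MulAut G) β] Multiplicative ℤ) where
  carrier := {s | s.left ∈ K m ∧ (a < m → s.right = 1)}
  one_mem' := ⟨one_mem _, fun _ => rfl⟩
  mul_mem' := by
    rintro s t ⟨hs, hs'⟩ ⟨ht, ht'⟩
    exact ⟨mul_mem hs ((hβ.zpow hK ha hc s.right.toAdd).map_mem hK ht), fun h => by
      rw [SemidirectProduct.mul_right, hs' h, ht' h, one_mul]⟩
  inv_mem' := by
    rintro s ⟨hs, hs'⟩
    exact ⟨(hβ.zpow hK ha hc (s.right⁻¹).toAdd).map_mem hK (inv_mem hs), fun h => by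
      rw [SemidirectProduct.inv_right, hs' h, inv_one]⟩

theorem isCentralFiltration_semidirect {G : Type*} [Group G] {K : ℕ → Subgroup G}
    (hK : IsCentralFiltration K) {a c : ℕ} (ha : 0 < a) (hc : K c = ⊥) {β : MulAut G}
    (hβ : IsShift K a β.toMonoidHom) :
    IsCentralFiltration (semidirectFiltration hK ha hc hβ) where
  antitone m n h := fun s hs => ⟨hK.mem_of_le h hs.1, fun h' => hs.2 (lt_of_lt_of_le h' h)⟩
  one_eq_top := by
    rw [eq_top_iff]
    exact fun s _ => ⟨hK.mem_one _, fun h => absurd h (by omega)⟩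
  commutator_mem := by
    intro i j s t hs ht
    -- the action of the `ℤ`-part of one element on the other is trivial modulo `K (i + j)`
    have move : ∀ {i j : ℕ} {s t : G ⋊[zpowersHom (MulAut G) β] Multiplicative ℤ},
        s ∈ semidirectFiltration hK ha hc hβ i → t ∈ semidirectFiltration hK ha hc hβ j →
        ∃ u ∈ K (i + j), (zpowersHom (MulAut G) β s.right) t.left = u * t.left := by
      intro i j s t hs ht
      refine ⟨_, ?_, (inv_mul_cancel_right _ _).symm⟩
      by_cases h : a < i
      · rw [hs.2 h, map_one, MulAut.one_apply, mul_inv_cancel]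
        exact one_mem _
      · exact hK.mem_of_le (by omega) ((hβ.zpow hK ha hc s.right.toAdd) j _ ht.1)
    obtain ⟨u, hu, hu'⟩ := move hs ht
    obtain ⟨v, hv, hv'⟩ := move ht hs
    rw [add_comm] at hv
    have hst : (⁅s, t⁆ * (t * s)) = s * t := by rw [commutatorElement_def]; group
    have hright : ⁅s, t⁆.right = 1 := by
      have := congrArg SemidirectProduct.right hst
      simp only [SemidirectProduct.mul_right] at this
      rwa [mul_comm s.right, mul_eq_right] at this
    refine ⟨?_, fun _ => hright⟩
    have hleft := congrArg SemidirectProduct.left hst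
    simp only [SemidirectProduct.mul_left, hright, map_one, MulAut.one_apply, hu', hv'] at hleft
    have : ⁅s, t⁆.left = (s.left * u * s.left⁻¹) * ⁅s.left, t.left⁆ *
        (t.left * v⁻¹ * t.left⁻¹) := by
      rw [← eq_mul_inv_iff_mul_eq] at hleft
      rw [hleft, commutatorElement_def]
      group
    rw [this]
    exact mul_mem (mul_mem (hK.conj_mem hu _) (hK.commutator_mem hs.1 ht.1))
      (hK.conj_mem (inv_mem hv) _)

end Filtration

/-! ### Weight filtrations of free groups -/

section Weights

/-- `WeightMem w m g`: the element `g` of the free group lies in the `m`-th term of the smallest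
central filtration in which every generator `x` has weight `w x`. -/
inductive WeightMem {X : Type*} (w : X → ℕ) : ℕ → FreeGroup X → Prop
  | one (m : ℕ) : WeightMem w m 1
  | mul {m : ℕ} {g h : FreeGroup X} : WeightMem w m g → WeightMem w m h → WeightMem w m (g * h)
  | inv {m : ℕ} {g : FreeGroup X} : WeightMem w m g → WeightMem w m g⁻¹
  | of (x : X) : WeightMem w (w x) (FreeGroup.of x)
  | mono {m n : ℕ} {g : FreeGroup X} : m ≤ n → WeightMem w n g → WeightMem w m g
  | comm {i j : ℕ} {g h : FreeGroup X} :
      WeightMem w i g → WeightMem w j h → WeightMem w (i + j) ⁅g, h⁆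

/-- The `m`-th term of the smallest central filtration of a free group in which every generator
`x` has weight `w x`. -/
def weightSubgroup {X : Type*} (w : X → ℕ) (m : ℕ) : Subgroup (FreeGroup X) where
  carrier := {g | WeightMem w m g}
  one_mem' := .one m
  mul_mem' := .mul
  inv_mem' := .inv

variable {X : Type*} {w : X → ℕ}

theorem of_mem_weightSubgroup (x : X) : FreeGroup.of x ∈ weightSubgroup w (w x) := .of x

theorem weightSubgroup_eq_top {m : ℕ} (h : ∀ x, m ≤ w x) : weightSubgroup w m = ⊤ := by
  rw [eq_top_iff]
  refine fun g _ => ?_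
  clear * -h
  induction g using FreeGroup.induction_on with
  | C1 => exact one_mem _
  | of x => exact WeightMem.mono (h x) (.of x)
  | inv_of x _ => exact inv_mem (WeightMem.mono (h x) (.of x))
  | mul g h hg hh => exact mul_mem hg hh

theorem isCentralFiltration_weightSubgroup (hw : ∀ x, 0 < w x) :
    IsCentralFiltration (weightSubgroup w) where
  antitone _ _ h _ hg := .mono h hg
  one_eq_top := weightSubgroup_eq_top hw
  commutator_mem := .comm

theorem normal_weightSubgroup (hw : ∀ x, 0 < w x) (m : ℕ) : (weightSubgroup w m).Normal :=
  ⟨fun _ hg h => (isCentralFiltration_weightSubgroup hw).conj_mem hg h⟩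

/-- The universal property of the weight filtration. -/
theorem lift_mem_of_mem_weightSubgroup {G : Type*} [Group G] {K : ℕ → Subgroup G}
    (hK : IsCentralFiltration K) (f : FreeGroup X →* G) (hf : ∀ x, f (.of x) ∈ K (w x)) {m : ℕ}
    {g : FreeGroup X} (hg : g ∈ weightSubgroup w m) : f g ∈ K m := by
  change WeightMem w m g at hg
  induction hg with
  | one m => simp
  | mul _ _ h1 h2 => rw [map_mul]; exact mul_mem h1 h2
  | inv _ h => rw [map_inv]; exact inv_mem h
  | of x => exact hf x
  | mono h _ ih => exact hK.mem_of_le h ih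
  | comm _ _ h1 h2 => rw [map_commutatorElement]; exact hK.commutator_mem h1 h2

/-- Homomorphisms that differ on generators by elements `a` steps deeper in the filtration do so
everywhere. -/
theorem map_mul_map_inv_mem_of_mem_weightSubgroup {G : Type*} [Group G] {K : ℕ → Subgroup G}
    (hK : IsCentralFiltration K) (φ ψ : FreeGroup X →* G) (a : ℕ) (hψ : ∀ x, ψ (.of x) ∈ K (w x))
    (hφ : ∀ x, φ (.of x) * (ψ (.of x))⁻¹ ∈ K (w x + a)) {m : ℕ} {g : FreeGroup X}
    (hg : g ∈ weightSubgroup w m) : φ g * (ψ g)⁻¹ ∈ K (m + a) := by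
  change WeightMem w m g at hg
  induction hg with
  | one m => simp
  | @mul m g h _ _ h1 h2 =>
    rw [map_mul, map_mul]
    convert mul_mem h1 (hK.conj_mem h2 (ψ g)) using 1
    group
  | @inv m g _ h =>
    rw [map_inv, map_inv]
    convert hK.conj_mem' (inv_mem h) (ψ g) using 1
    group
  | of x => exact hφ x
  | mono h _ ih => exact hK.mem_of_le (by omega) ih
  | @comm i j g h hg hh h1 h2 =>
    have hg' := lift_mem_of_mem_weightSubgroup hK ψ hψ hg
    have hh' := lift_mem_of_mem_weightSubgroup hK ψ hψ hh
    rw [map_commutatorElement, map_commutatorElement]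
    generalize φ g = p at *
    generalize φ h = q at *
    generalize ψ g = g at *
    generalize ψ h = h at *
    obtain ⟨v, rfl⟩ : ∃ v, p = v * g := ⟨p * g⁻¹, by group⟩
    obtain ⟨u, rfl⟩ : ∃ u, q = u * h := ⟨q * h⁻¹, by group⟩
    rw [mul_inv_cancel_right] at h1 h2
    have e : ⁅v * g, u * h⁆ * ⁅g, h⁆⁻¹ =
        ⁅v * g, u⁆ * (u * ⁅v, ⁅g, h⁆⁆ * u⁻¹) * ⁅u, ⁅g, h⁆⁆ *
          (⁅g, h⁆ * (u * ⁅v, h⁆ * u⁻¹) * ⁅g, h⁆⁻¹) := by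
      simp only [commutatorElement_def]
      group
    rw [e]
    have hvg : v * g ∈ K i := mul_mem (hK.mem_of_le (by omega) h1) hg'
    have hgh := hK.commutator_mem hg' hh'
    refine mul_mem (mul_mem (mul_mem ?_ (hK.conj_mem ?_ _)) ?_) (hK.conj_mem (hK.conj_mem ?_ _) _)
    · exact hK.mem_of_le (by omega) (hK.commutator_mem hvg h2)
    · exact hK.mem_of_le (by omega) (hK.commutator_mem h1 hgh)
    · exact hK.mem_of_le (by omega) (hK.commutator_mem h2 hgh)
    · exact hK.mem_of_le (by omega) (hK.commutator_mem h1 hh')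

end Weights

/-! ### Elimination of generators and torsion-freeness -/

section Elimination

variable {X : Type*} (w : X → ℕ) (x₀ : X)

/-- The weights of the generators `(y, n)` that replace `x₀` and the `y ≠ x₀` when `x₀` is
eliminated; `(y, n)` stands for an iterated commutator of `y` with `n` factors `x₀`. -/
def eliminationWeight (p : {y : X // y ≠ x₀} × ℕ) : ℕ := w p.1 + p.2 * w x₀

/-- The element of the free group on `X` for which the generator `(y, n)` stands. -/
def eliminationWord (y : X) : ℕ → FreeGroup X
  | 0 => FreeGroup.of y
  | n + 1 => ⁅(eliminationWord y n)⁻¹, FreeGroup.of x₀⁆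

/-- The endomorphism `(y, n) ↦ (y, n) (y, n + 1)`, which describes conjugation by `x₀`. -/
def eliminationShift : FreeGroup ({y : X // y ≠ x₀} × ℕ) →* FreeGroup ({y : X // y ≠ x₀} × ℕ) :=
  FreeGroup.lift fun p => FreeGroup.of p * FreeGroup.of (p.1, p.2 + 1)

variable {w} {x₀}

theorem eliminationWord_mem (y : {y : X // y ≠ x₀}) (n : ℕ) :
    eliminationWord x₀ (y : X) n ∈ weightSubgroup w (eliminationWeight w x₀ (y, n)) := by
  induction n with
  | zero => simpa [eliminationWeight, eliminationWord] using of_mem_weightSubgroup (w := w) (y : X)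
  | succ n ih =>
    have := WeightMem.comm (WeightMem.inv ih) (WeightMem.of (w := w) x₀)
    have e : eliminationWeight w x₀ (y, n + 1) = eliminationWeight w x₀ (y, n) + w x₀ := by
      simp only [eliminationWeight]; ring
    rw [e]
    exact this

theorem eliminationWeight_pos (hw : ∀ x, 0 < w x) (p : {y : X // y ≠ x₀} × ℕ) :
    0 < eliminationWeight w x₀ p :=
  Nat.add_pos_left (hw _) _

theorem eliminationShift_mul_inv_mem (hw : ∀ x, 0 < w x) {m : ℕ}
    {g : FreeGroup ({y : X // y ≠ x₀} × ℕ)} (hg : g ∈ weightSubgroup (eliminationWeight w x₀) m) :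
    eliminationShift x₀ g * g⁻¹ ∈ weightSubgroup (eliminationWeight w x₀) (m + w x₀) := by
  have hK := isCentralFiltration_weightSubgroup (eliminationWeight_pos (x₀ := x₀) hw)
  refine map_mul_map_inv_mem_of_mem_weightSubgroup hK (eliminationShift x₀) (MonoidHom.id _) (w x₀)
    of_mem_weightSubgroup (fun p => ?_) hg
  have : eliminationWeight w x₀ p + w x₀ = eliminationWeight w x₀ (p.1, p.2 + 1) := by
    simp only [eliminationWeight]; ring
  rw [this, eliminationShift, FreeGroup.lift_apply_of, MonoidHom.id_apply]
  exact hK.conj_mem (of_mem_weightSubgroup _) _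

/-- A free group modulo a term of its weight filtration embeds in a semidirect product with `ℤ` of
such a quotient that has fewer generators of the least weight. Hence torsion-freeness is inherited
from the latter. -/
theorem mem_weightSubgroup_of_pow_mem_of_elimination (c : ℕ) (hw : ∀ x, 0 < w x) (hx₀ : w x₀ ≤ c)
    (h : ∀ (g : FreeGroup ({y : X // y ≠ x₀} × ℕ)) (k : ℕ), k ≠ 0 →
      g ^ k ∈ weightSubgroup (eliminationWeight w x₀) (c + 1) →
      g ∈ weightSubgroup (eliminationWeight w x₀) (c + 1))
    (g : FreeGroup X) (k : ℕ) (hk : k ≠ 0) (hg : g ^ k ∈ weightSubgroup w (c + 1)) :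
    g ∈ weightSubgroup w (c + 1) := by
  classical
  have hw' := eliminationWeight_pos (x₀ := x₀) hw
  have := normal_weightSubgroup hw (c + 1)
  have := normal_weightSubgroup hw' (c + 1)
  set W := weightSubgroup w (c + 1)
  set W' := weightSubgroup (eliminationWeight w x₀) (c + 1)
  set π := QuotientGroup.mk' W
  set π' := QuotientGroup.mk' W'
  have hF := isCentralFiltration_weightSubgroup hw
  have hF' := isCentralFiltration_weightSubgroup hw'
  have hK := hF'.map_of_surjective π' (QuotientGroup.mk'_surjective W')
  have hK1 : (weightSubgroup (eliminationWeight w x₀) (c + 1)).map π' = ⊥ := by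
    rw [Subgroup.map_eq_bot_iff, QuotientGroup.ker_mk']
  -- conjugation by `x₀` as an automorphism `β` of the quotient
  have hα : W' ≤ W'.comap (eliminationShift x₀) := fun g hg => by
    have := eliminationShift_mul_inv_mem hw hg
    have := mul_mem (hF'.mem_of_le (Nat.le_add_right _ _) this) hg
    rwa [inv_mul_cancel_right] at this
  set α := QuotientGroup.map W' W' (eliminationShift x₀) hα
  have hα_mk : ∀ g, α (π' g) = π' (eliminationShift x₀ g) := fun g => rfl
  have hshift : IsShift (fun m => (weightSubgroup (eliminationWeight w x₀) m).map π') (w x₀) α := by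
    rintro m _ ⟨g, hg, rfl⟩
    exact ⟨_, eliminationShift_mul_inv_mem hw hg, by rw [hα_mk, map_mul, map_inv]⟩
  set β : MulAut (_ ⧸ W') := MulEquiv.ofBijective α (hshift.bijective hK (hw x₀) hK1)
  have hβ : IsShift (fun m => (weightSubgroup (eliminationWeight w x₀) m).map π') (w x₀)
      β.toMonoidHom := hshift
  have hS := isCentralFiltration_semidirect hK (hw x₀) hK1 hβ
  -- the embedding `f` of the quotient into the semidirect product
  let f : FreeGroup X →* (_ ⧸ W') ⋊[zpowersHom (MulAut _) β] Multiplicative ℤ :=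
    FreeGroup.lift fun y => if hy : y = x₀ then SemidirectProduct.inr (Multiplicative.ofAdd 1)
      else SemidirectProduct.inl (π' (FreeGroup.of (⟨y, hy⟩, 0)))
  have hf : ∀ {m : ℕ} {g : FreeGroup X}, g ∈ weightSubgroup w m →
      f g ∈ semidirectFiltration hK (hw x₀) hK1 hβ m := by
    intro m g hg
    refine lift_mem_of_mem_weightSubgroup hS f (fun y => ?_) hg
    rw [FreeGroup.lift_apply_of]
    split_ifs with hy
    · subst hy
      exact ⟨one_mem _, fun h => absurd h (lt_irrefl _)⟩
    · refine ⟨⟨_, ?_, rfl⟩, fun _ => rfl⟩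
      have := of_mem_weightSubgroup (w := eliminationWeight w x₀) (⟨y, hy⟩, 0)
      simpa [eliminationWeight] using this
  -- its left inverse `r`
  let d : FreeGroup ({y : X // y ≠ x₀} × ℕ) →* FreeGroup X :=
    FreeGroup.lift fun p => eliminationWord x₀ p.1 p.2
  have hd : W' ≤ W.comap d := fun g hg => by
    refine lift_mem_of_mem_weightSubgroup hF d (fun p => ?_) hg
    rw [FreeGroup.lift_apply_of]
    exact eliminationWord_mem p.1 p.2
  let δ : (_ ⧸ W') →* (_ ⧸ W) := QuotientGroup.map W' W d hd
  have hδβ : ∀ q, δ (β q) = MulAut.conj (π (FreeGroup.of x₀)) (δ q) := by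
    have : (δ.comp α).comp π' =
        ((MulAut.conj (π (FreeGroup.of x₀))).toMonoidHom.comp δ).comp π' := by
      refine FreeGroup.ext_hom _ _ fun p => ?_
      change π (d (eliminationShift x₀ (FreeGroup.of p))) =
        π (FreeGroup.of x₀) * π (d (FreeGroup.of p)) * (π (FreeGroup.of x₀))⁻¹
      rw [eliminationShift, FreeGroup.lift_apply_of, map_mul, FreeGroup.lift_apply_of,
        FreeGroup.lift_apply_of, ← map_mul, ← map_inv, ← map_mul, eliminationWord,
        commutatorElement_def]
      congr 1
      group
    intro q
    obtain ⟨g, rfl⟩ := QuotientGroup.mk'_surjective W' q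
    exact DFunLike.congr_fun this g
  have hδ : ∀ (n : ℤ) (q), δ ((β ^ n) q) = MulAut.conj (π (FreeGroup.of x₀) ^ n) (δ q) := by
    intro n
    induction n with
    | zero => simp
    | succ n ih =>
      intro q
      rw [zpow_add_one, zpow_add_one, map_mul, MulAut.mul_apply, MulAut.mul_apply, ih, hδβ]
    | pred n ih =>
      intro q
      have : q = β (β⁻¹ q) := by simp
      rw [zpow_sub_one, zpow_sub_one, map_mul, MulAut.mul_apply, MulAut.mul_apply, ih]
      conv_rhs => rw [this, hδβ, map_inv, MulAut.inv_apply_self]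
  let r : (_ ⧸ W') ⋊[zpowersHom (MulAut _) β] Multiplicative ℤ →* (_ ⧸ W) :=
    SemidirectProduct.lift δ (zpowersHom _ (π (FreeGroup.of x₀))) fun n =>
      MonoidHom.ext fun q => hδ n.toAdd q
  have hr : r.comp f = π := by
    refine FreeGroup.ext_hom _ _ fun y => ?_
    rw [MonoidHom.comp_apply, FreeGroup.lift_apply_of]
    split_ifs with hy
    · rw [SemidirectProduct.lift_inr, hy, zpowersHom_apply, toAdd_ofAdd, zpow_one]
    · rw [SemidirectProduct.lift_inl]
      change π (d (FreeGroup.of _)) = _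
      rw [FreeGroup.lift_apply_of, eliminationWord]
  -- torsion-freeness of the semidirect product
  have hfk : f g ^ k = 1 := by
    rw [← map_pow]
    obtain ⟨h1, h2⟩ := hf hg
    refine SemidirectProduct.ext ?_ (h2 (by omega))
    change _ ∈ (weightSubgroup (eliminationWeight w x₀) (c + 1)).map π' at h1
    rw [hK1] at h1
    exact h1
  have hright : (f g).right = 1 := by
    have := congrArg (SemidirectProduct.rightHom) hfk
    rw [map_pow, map_one] at this
    have h2 : k • (f g).right.toAdd = 0 := this
    exact (smul_eq_zero.mp h2).resolve_left hk
  obtain ⟨q, hq⟩ : ∃ q, f g = SemidirectProduct.inl q :=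
    ⟨(f g).left, SemidirectProduct.ext rfl hright⟩
  rw [hq, ← map_pow] at hfk
  have hqk : q ^ k = 1 := SemidirectProduct.inl_injective (hfk.trans (map_one _).symm)
  obtain ⟨g', rfl⟩ := QuotientGroup.mk'_surjective W' q
  have hg' : g' ∈ W' := by
    refine h g' k hk ?_
    rw [← QuotientGroup.ker_mk' W', MonoidHom.mem_ker, map_pow]
    exact hqk
  have : f g = 1 := by
    rw [hq, MonoidHom.mem_ker.mp ((QuotientGroup.ker_mk' W').symm ▸ hg' : g' ∈ _), map_one]
  have h1 : π g = 1 := by rw [← hr, MonoidHom.comp_apply, this, map_one]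
  rwa [← MonoidHom.mem_ker, QuotientGroup.ker_mk'] at h1

theorem finite_eliminationWeight_le (hw : ∀ x, 0 < w x) {c : ℕ} (h : {x | w x ≤ c}.Finite) :
    {p | eliminationWeight w x₀ p ≤ c}.Finite := by
  have h1 : {y : {y : X // y ≠ x₀} | w y ≤ c}.Finite :=
    h.preimage Subtype.val_injective.injOn
  refine (h1.prod (Set.finite_Iic c)).subset ?_
  rintro ⟨y, n⟩ hp
  simp only [eliminationWeight, Set.mem_ofPred_eq] at hp
  have := Nat.le_mul_of_pos_right n (hw x₀)
  exact ⟨by simp only [Set.mem_ofPred_eq]; omega, by simp only [Set.mem_Iic]; omega⟩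

theorem ncard_eliminationWeight_eq (hw : ∀ x, w x₀ ≤ w x) (h0 : 0 < w x₀) :
    {p | eliminationWeight w x₀ p = w x₀}.ncard = ({x | w x = w x₀} \ {x₀}).ncard := by
  have e : {x | w x = w x₀} \ {x₀} = (fun p : {y : X // y ≠ x₀} × ℕ => (p.1 : X)) ''
      {p | eliminationWeight w x₀ p = w x₀} := by
    ext y
    constructor
    · rintro ⟨hy, hy'⟩
      exact ⟨(⟨y, hy'⟩, 0), by simpa [eliminationWeight] using hy, rfl⟩
    · rintro ⟨⟨⟨y, hy⟩, n⟩, hp, rfl⟩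
      simp only [eliminationWeight, Set.mem_ofPred_eq] at hp
      have := hw y
      exact ⟨by simp only [Set.mem_ofPred_eq]; omega, hy⟩
  rw [e, Set.InjOn.ncard_image]
  rintro ⟨⟨y, hy⟩, n⟩ hp ⟨⟨z, hz⟩, m⟩ hp' hyz
  simp only [eliminationWeight, Set.mem_ofPred_eq] at hp hp' hyz
  subst hyz
  have := hw y
  have hn : n * w x₀ = 0 := by omega
  have hm : m * w x₀ = 0 := by omega
  have hn := (Nat.mul_eq_zero.mp hn).resolve_right (by omega)
  have hm := (Nat.mul_eq_zero.mp hm).resolve_right (by omega)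
  subst hn hm
  rfl

/-- A free group modulo a term of a weight filtration is torsion-free: the generators of least
weight are eliminated one after the other, until all weights exceed `c`. -/
theorem mem_weightSubgroup_of_pow_mem (c d : ℕ) {X : Type*} (w : X → ℕ) (hw : ∀ x, 0 < w x)
    (hfin : {x | w x ≤ c}.Finite) (hd : ∀ x, c + 1 ≤ w x + d) (g : FreeGroup X) (k : ℕ)
    (hk : k ≠ 0) (hg : g ^ k ∈ weightSubgroup w (c + 1)) : g ∈ weightSubgroup w (c + 1) := by
  induction d generalizing X k with
  | zero => rw [weightSubgroup_eq_top (w := w) hd]; trivial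
  | succ d ihd =>
    obtain ⟨n, hn⟩ : ∃ n, {x | w x + d = c}.ncard = n := ⟨_, rfl⟩
    induction n generalizing X k with
    | zero =>
      have h0 := (Set.ncard_eq_zero (hfin.subset fun x hx => by
        simp only [Set.mem_ofPred_eq] at hx ⊢; omega)).mp hn
      refine ihd w hw hfin (fun x => ?_) g k hk hg
      have h1 := hd x
      have h2 : ¬ (w x + d = c) := fun h => (h0 ▸ h : x ∈ (∅ : Set X))
      omega
    | succ n ihn =>
      obtain ⟨x₀, hx₀⟩ := Set.nonempty_of_ncard_ne_zero (by omega : {x | w x + d = c}.ncard ≠ 0)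
      simp only [Set.mem_ofPred_eq] at hx₀
      have key : ∀ m, m + d = c ↔ m = w x₀ := fun m => by omega
      simp only [key] at hn
      refine mem_weightSubgroup_of_pow_mem_of_elimination (x₀ := x₀) c hw (by omega)
        (fun g k hk hg => ?_) g k hk hg
      refine ihn (eliminationWeight w x₀) (eliminationWeight_pos hw)
        (finite_eliminationWeight_le hw hfin) (fun p => ?_) g k hk hg ?_
      · have := hd p.1
        simp only [eliminationWeight]
        omega
      · simp only [key]
        rw [ncard_eliminationWeight_eq (fun x => by have := hd x; omega) (hw x₀),
          Set.ncard_sdiff_singleton_of_mem (by simp), hn]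
        rfl

/-- The quotient of a finitely generated free group by a term of its lower central series is
torsion-free. -/
theorem mem_lcs_of_pow_mem {X : Type*} [Finite X] (c : ℕ) (g : FreeGroup X) (k : ℕ) (hk : k ≠ 0)
    (hg : g ^ k ∈ lcs (FreeGroup X) c) : g ∈ lcs (FreeGroup X) c := by
  have hK := isCentralFiltration_weightSubgroup (w := fun _ : X => 1) fun _ => one_pos
  have h1 : lcs (FreeGroup X) c ≤ weightSubgroup (fun _ : X => 1) (c + 1) :=
    Subgroup.descending_central_series_ge_lower (fun m => weightSubgroup (fun _ : X => 1) (m + 1))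
      ⟨hK.one_eq_top, fun x n hx g => hK.commutator_mem hx (hK.mem_one g)⟩ c
  have h2 := mem_weightSubgroup_of_pow_mem c c (fun _ : X => 1) (fun _ => one_pos)
    (Set.toFinite _) (fun _ => by omega) g k hk (h1 hg)
  exact lift_mem_of_mem_weightSubgroup (isCentralFiltration_lcs (FreeGroup X)) (MonoidHom.id _)
    (fun _ => Subgroup.mem_top _) h2

end Elimination

/-! ### Bases of free nilpotent groups -/

section Bases

/-- The family `b` is a basis of `G` as a free nilpotent group of class `k`. -/
def IsNilBasis {G ι : Type*} [Group G] (k : ℕ) (b : ι → G) : Prop :=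
  Function.Surjective (FreeGroup.lift b) ∧ (FreeGroup.lift b).ker = lcs (FreeGroup ι) k

theorem isNilBasis_subtype_val {G : Type*} [Group G] {k : ℕ} {B : Set G} :
    IsNilBasis k (Subtype.val : B → G) ↔ IsFreeNilpotentBasis k B := Iff.rfl

namespace IsNilBasis

variable {G H ι κ : Type*} [Group G] [Group H] {k : ℕ} {b : ι → G} (hb : IsNilBasis k b)
include hb

theorem lcs_eq_bot : lcs G k = ⊥ := by
  have h := Subgroup.map_lowerCentralSeries (⊤ : Subgroup (FreeGroup ι)) (FreeGroup.lift b) k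
  rw [Subgroup.map_top_of_surjective _ hb.1] at h
  refine h.symm.trans ?_
  rw [Subgroup.map_eq_bot_iff, hb.2]

theorem hom_ext {φ ψ : G →* H} (h : ∀ i, φ (b i) = ψ (b i)) : φ = ψ := by
  have : φ.comp (FreeGroup.lift b) = ψ.comp (FreeGroup.lift b) :=
    FreeGroup.ext_hom _ _ fun i => by simpa using h i
  exact (MonoidHom.cancel_right hb.1).mp this

/-- The universal property of free nilpotent groups. -/
theorem exists_hom (hH : lcs H k = ⊥) (f : ι → H) : ∃ φ : G →* H, ∀ i, φ (b i) = f i := by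
  have hker : (FreeGroup.lift b).ker ≤ (FreeGroup.lift f).ker := by
    rw [hb.2]
    intro g hg
    have := map_mem_lcs (FreeGroup.lift f) hg
    rwa [hH] at this
  refine ⟨(FreeGroup.lift b).liftOfSurjective hb.1 ⟨FreeGroup.lift f, hker⟩, fun i => ?_⟩
  have := (FreeGroup.lift b).liftOfRightInverse_comp_apply _
    (Function.rightInverse_surjInv hb.1) ⟨FreeGroup.lift f, hker⟩ (FreeGroup.of i)
  simpa using this

theorem range_le {φ : G →* H} {S : Subgroup H} (h : ∀ i, φ (b i) ∈ S) (g : G) : φ g ∈ S := by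
  obtain ⟨w, rfl⟩ := hb.1 g
  induction w using FreeGroup.induction_on with
  | C1 => simp
  | of i => simpa using h i
  | inv_of i _ => simpa using h i
  | mul g h hg hh => rw [map_mul, map_mul]; exact mul_mem hg hh

theorem comp_equiv (e : κ ≃ ι) : IsNilBasis k (b ∘ e) := by
  have h : FreeGroup.lift (b ∘ e) =
      (FreeGroup.lift b).comp (FreeGroup.freeGroupCongr e).toMonoidHom :=
    FreeGroup.ext_hom _ _ fun i => by simp
  refine ⟨?_, ?_⟩
  · rw [h]
    exact hb.1.comp (FreeGroup.freeGroupCongr e).surjective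
  · ext g
    rw [h, MonoidHom.mem_ker, MonoidHom.comp_apply, ← MonoidHom.mem_ker, hb.2]
    exact map_mem_lcs_iff (FreeGroup.freeGroupCongr e)

theorem map_mulEquiv (σ : G ≃* H) : IsNilBasis k fun i => σ (b i) := by
  have h : FreeGroup.lift (fun i => σ (b i)) = σ.toMonoidHom.comp (FreeGroup.lift b) :=
    FreeGroup.ext_hom _ _ fun i => by simp
  refine ⟨?_, ?_⟩
  · rw [h]
    exact σ.surjective.comp hb.1
  · rw [h, ← hb.2]
    ext g
    simp [MonoidHom.mem_ker]

/-- The coordinate homomorphism `G → ℤ` of a basis element. -/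
theorem exists_coord [DecidableEq ι] (hk : k ≠ 0) (i : ι) :
    ∃ f : G →* Multiplicative ℤ, ∀ j, f (b j) = Multiplicative.ofAdd (if j = i then 1 else 0) :=
  hb.exists_hom (lcs_eq_bot_of_commGroup hk) _

theorem injective (hk : k ≠ 0) : Function.Injective b := by
  classical
  intro i j hij
  obtain ⟨f, hf⟩ := hb.exists_coord hk i
  have h1 := hf i
  have h2 := hf j
  rw [← hij, h1] at h2
  by_contra hne
  simp [Ne.symm hne] at h2

theorem isFreeNilpotentBasis_range (hk : k ≠ 0) : IsFreeNilpotentBasis k (Set.range b) := by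
  have h := hb.comp_equiv (Equiv.ofInjective b (hb.injective hk)).symm
  have e : b ∘ (Equiv.ofInjective b (hb.injective hk)).symm = Subtype.val := by
    funext x
    exact congrArg Subtype.val ((Equiv.ofInjective b (hb.injective hk)).apply_symm_apply x)
  rwa [e] at h

theorem isPrimitiveElement (hk : k ≠ 0) (i : ι) : IsPrimitiveElement k (b i) :=
  ⟨_, hb.isFreeNilpotentBasis_range hk, i, rfl⟩

/-- The automorphism that permutes a basis. -/
theorem exists_perm_mulAut (e : Equiv.Perm ι) : ∃ σ : MulAut G, ∀ i, σ (b i) = b (e i) := by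
  obtain ⟨φ, hφ⟩ := hb.exists_hom hb.lcs_eq_bot fun i => b (e i)
  obtain ⟨ψ, hψ⟩ := hb.exists_hom hb.lcs_eq_bot fun i => b (e.symm i)
  refine ⟨MonoidHom.toMulEquiv φ ψ (hb.hom_ext fun i => ?_) (hb.hom_ext fun i => ?_), hφ⟩
  · simp [hφ, hψ]
  · simp [hφ, hψ]

/-- The elementary Nielsen automorphism that multiplies one basis element by another. -/
theorem exists_transvection [DecidableEq ι] {i j : ι} (hij : i ≠ j) :
    ∃ σ : MulAut G, σ (b i) = b i * b j ∧ ∀ l, l ≠ i → σ (b l) = b l := by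
  obtain ⟨φ, hφ⟩ := hb.exists_hom hb.lcs_eq_bot fun l => if l = i then b i * b j else b l
  obtain ⟨ψ, hψ⟩ := hb.exists_hom hb.lcs_eq_bot fun l => if l = i then b i * (b j)⁻¹ else b l
  refine ⟨MonoidHom.toMulEquiv φ ψ (hb.hom_ext fun l => ?_) (hb.hom_ext fun l => ?_), ?_, ?_⟩
  · by_cases h : l = i <;> simp [hφ, hψ, h, Ne.symm hij]
  · by_cases h : l = i <;> simp [hφ, hψ, h, Ne.symm hij]
  · exact (hφ i).trans (if_pos rfl)
  · exact fun l h => (hφ l).trans (if_neg h)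

/-- The elementary Nielsen automorphism that inverts one basis element. -/
theorem exists_inversion [DecidableEq ι] (i : ι) : ∃ σ : MulAut G, σ (b i) = (b i)⁻¹ := by
  obtain ⟨φ, hφ⟩ := hb.exists_hom hb.lcs_eq_bot fun l => if l = i then (b i)⁻¹ else b l
  have h : φ.comp φ = MonoidHom.id G := hb.hom_ext fun l => by
    by_cases h : l = i <;> simp [hφ, h]
  exact ⟨MonoidHom.toMulEquiv φ φ h h, (hφ i).trans (if_pos rfl)⟩

/-- Every element lies in the subgroup generated by finitely many basis elements. -/
theorem exists_finset_mem_closure (g : G) :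
    ∃ A : Finset ι, g ∈ Subgroup.closure (b '' (A : Set ι)) := by
  classical
  obtain ⟨w, rfl⟩ := hb.1 g
  have mono : ∀ {A C : Finset ι}, A ⊆ C →
      Subgroup.closure (b '' (A : Set ι)) ≤ Subgroup.closure (b '' (C : Set ι)) :=
    fun h => Subgroup.closure_mono (Set.image_mono (Finset.coe_subset.mpr h))
  induction w using FreeGroup.induction_on with
  | C1 => exact ⟨∅, by simp⟩
  | of i => exact ⟨{i}, Subgroup.subset_closure ⟨i, by simp, by simp⟩⟩
  | inv_of i h =>
    obtain ⟨A, hA⟩ := h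
    exact ⟨A, by rw [map_inv]; exact inv_mem hA⟩
  | mul g h hg hh =>
    obtain ⟨A, hA⟩ := hg
    obtain ⟨C, hC⟩ := hh
    refine ⟨A ∪ C, ?_⟩
    rw [map_mul]
    exact mul_mem (mono Finset.subset_union_left hA) (mono Finset.subset_union_right hC)

theorem infinite_of_infinite [Infinite ι] {b' : κ → G} (hb' : IsNilBasis k b') (hk : k ≠ 0) :
    Infinite κ := by
  classical
  by_contra hκ
  have : Finite κ := not_infinite_iff_finite.mp hκ
  have := Fintype.ofFinite κ
  choose A hA using fun l => hb.exists_finset_mem_closure (b' l)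
  obtain ⟨i, hi⟩ := Infinite.exists_notMem_finset (Finset.univ.biUnion A)
  obtain ⟨f, hf⟩ := hb.exists_coord hk i
  have h0 : ∀ l, f (b' l) ∈ (⊥ : Subgroup (Multiplicative ℤ)) := by
    intro l
    have : Subgroup.closure (b '' (A l : Set ι)) ≤ f.ker := by
      rw [Subgroup.closure_le]
      rintro _ ⟨j, hj, rfl⟩
      have hji : j ≠ i := fun e => hi (Finset.mem_biUnion.mpr ⟨l, Finset.mem_univ l, e ▸ hj⟩)
      simp [hf, hji]
    exact this (hA l)
  have h1 := hb'.range_le h0 (b i)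
  rw [hf, Subgroup.mem_bot] at h1
  simp at h1

end IsNilBasis

theorem IsPrimitiveElement.map_mulAut {G : Type*} [Group G] {k : ℕ} (hk : k ≠ 0) {x : G}
    (hx : IsPrimitiveElement k x) (σ : MulAut G) : IsPrimitiveElement k (σ x) := by
  obtain ⟨B, hB, hxB⟩ := hx
  exact ((isNilBasis_subtype_val.mpr hB).map_mulEquiv σ).isPrimitiveElement hk ⟨x, hxB⟩

theorem IsPrimitiveElement.inv {G : Type*} [Group G] {k : ℕ} (hk : k ≠ 0) {x : G}
    (hx : IsPrimitiveElement k x) : IsPrimitiveElement k x⁻¹ := by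
  classical
  obtain ⟨B, hB, hxB⟩ := hx
  obtain ⟨σ, hσ⟩ := (isNilBasis_subtype_val.mpr hB).exists_inversion ⟨x, hxB⟩
  have hσ : σ x = x⁻¹ := hσ
  exact hσ ▸ IsPrimitiveElement.map_mulAut hk ⟨B, hB, hxB⟩ σ

end Bases

/-! ### Central elements are products of commutators -/

section Center

/-- The integral Heisenberg group: triples of integers with the product
`(a, b, c) (a', b', c') = (a + a', b + b', c + c' + a b')`. -/
@[ext]
structure Heisenberg where
  /-- the first coordinate -/
  a : ℤ
  /-- the second coordinate -/
  b : ℤ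
  /-- the central coordinate -/
  c : ℤ

namespace Heisenberg

instance : Mul Heisenberg := ⟨fun s t => ⟨s.a + t.a, s.b + t.b, s.c + t.c + s.a * t.b⟩⟩
instance : One Heisenberg := ⟨⟨0, 0, 0⟩⟩
instance : Inv Heisenberg := ⟨fun s => ⟨-s.a, -s.b, -s.c + s.a * s.b⟩⟩

@[simp] theorem mul_a (s t : Heisenberg) : (s * t).a = s.a + t.a := rfl
@[simp] theorem mul_b (s t : Heisenberg) : (s * t).b = s.b + t.b := rfl
@[simp] theorem mul_c (s t : Heisenberg) : (s * t).c = s.c + t.c + s.a * t.b := rfl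
@[simp] theorem one_a : (1 : Heisenberg).a = 0 := rfl
@[simp] theorem one_b : (1 : Heisenberg).b = 0 := rfl
@[simp] theorem one_c : (1 : Heisenberg).c = 0 := rfl
@[simp] theorem inv_a (s : Heisenberg) : s⁻¹.a = -s.a := rfl
@[simp] theorem inv_b (s : Heisenberg) : s⁻¹.b = -s.b := rfl
@[simp] theorem inv_c (s : Heisenberg) : s⁻¹.c = -s.c + s.a * s.b := rfl

instance : Group Heisenberg :=
  Group.ofLeftAxioms
    (fun r s t => by ext <;> simp <;> ring)
    (fun s => by ext <;> simp)
    (fun s => by ext <;> simp)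

/-- The first coordinate as a homomorphism. -/
def fst : Heisenberg →* Multiplicative ℤ where
  toFun s := Multiplicative.ofAdd s.a
  map_one' := rfl
  map_mul' _ _ := rfl

theorem mem_center_of_eq_zero {s : Heisenberg} (ha : s.a = 0) (hb : s.b = 0) :
    s ∈ Subgroup.center Heisenberg :=
  Subgroup.mem_center_iff.mpr fun t => by ext <;> simp [ha, hb, add_comm]

theorem lcs_two : lcs Heisenberg 2 = ⊥ := by
  refine Subgroup.commutator_top_right_eq_bot_iff_le_center.mpr ?_
  refine Subgroup.commutator_le.mpr fun s _ t _ => mem_center_of_eq_zero ?_ ?_ <;>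
  simp [commutatorElement_def]

end Heisenberg

namespace IsNilBasis

variable {G ι : Type*} [Group G] {k : ℕ} {b : ι → G} (hb : IsNilBasis k b)
include hb

/-- An element on which all coordinate homomorphisms vanish is a product of commutators. -/
theorem mem_lcs_one_of_coord_eq_one (hk : k ≠ 0) {g : G}
    (h : ∀ (i : ι) (f : G →* Multiplicative ℤ), (∀ j, j ≠ i → f (b j) = 1) → f g = 1) :
    g ∈ lcs G 1 := by
  classical
  obtain ⟨T, hT⟩ := hb.exists_hom (H := Multiplicative (ι →₀ ℤ))
    (lcs_eq_bot_of_commGroup hk)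
    fun i => Multiplicative.ofAdd (Finsupp.single i 1)
  let S : Multiplicative (ι →₀ ℤ) →* Abelianization G := AddMonoidHom.toMultiplicativeLeft
    (Finsupp.liftAddHom fun i => zmultiplesHom _ (Additive.ofMul (Abelianization.of (b i))))
  have hST : S.comp T = Abelianization.of := hb.hom_ext fun i => by
    simp [S, hT]
  have hTg : T g = 1 := by
    refine Multiplicative.toAdd.injective (Finsupp.ext fun i => ?_)
    have := h i ((Finsupp.applyAddHom i).toMultiplicative.comp T) fun j hj => by
      simp [hT, hj]
    exact this
  have : Abelianization.of g = 1 := by rw [← hST, MonoidHom.comp_apply, hTg, map_one]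
  rwa [← MonoidHom.mem_ker, Abelianization.ker_of] at this

/-- Seen in a Heisenberg quotient, a central element has trivial coordinates. -/
theorem center_le_lcs_one [Nontrivial ι] (hk : 2 ≤ k) : Subgroup.center G ≤ lcs G 1 := by
  classical
  intro t ht
  refine hb.mem_lcs_one_of_coord_eq_one (by omega) fun i f hf => ?_
  obtain ⟨j, hj⟩ := exists_ne i
  obtain ⟨φ, hφ⟩ := hb.exists_hom (lcs_eq_bot_of_le hk Heisenberg.lcs_two) fun l =>
    if l = i then (⟨(f (b i)).toAdd, 0, 0⟩ : Heisenberg) else if l = j then ⟨0, 1, 0⟩ else 1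
  have hfst : Heisenberg.fst.comp φ = f := hb.hom_ext fun l => by
    rw [MonoidHom.comp_apply, hφ]
    by_cases hl : l = i
    · subst hl
      rw [if_pos rfl]
      rfl
    · rw [if_neg hl, hf l hl]
      split_ifs <;> rfl
  have hcomm : φ t * φ (b j) = φ (b j) * φ t := by
    rw [← map_mul, ← map_mul, Subgroup.mem_center_iff.mp ht]
  have ha : (φ t).a = 0 := by
    have := congrArg Heisenberg.c hcomm
    simpa [hφ, hj] using this
  rw [← hfst]
  exact congrArg Multiplicative.ofAdd ha

end IsNilBasis

end Center

/-! ### Elements fixed by stabilizers -/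

section FixedElements

/-- A partial surjection of an infinite set onto itself that is the identity on a given finite set
`S ∪ A`, but is undefined at the images of `A \ S` under a permutation that fixes `S`. -/
theorem exists_perm_and_partial_surjection {ι : Type*} [Infinite ι] [DecidableEq ι]
    (S A : Finset ι) :
    ∃ (e : Equiv.Perm ι) (p : ι → Option ι), (∀ i ∈ S, e i = i) ∧ (∀ i ∈ S ∪ A, p i = some i) ∧
      (∀ i ∈ A, i ∉ S → p (e i) = none) ∧ ∀ j, ∃ i, p i = some j := by
  classical
  set C := S ∪ A with hC
  set m := C.card
  have : Infinite {i // i ∉ C} := (Set.Finite.infinite_compl C.finite_toSet).to_subtype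
  let ν : ℕ ↪ {i // i ∉ C} := Infinite.natEmbedding _
  have hν : ∀ {n n'}, (ν n : ι) = ν n' → n = n' := fun h => ν.injective (Subtype.ext h)
  let idx : C ≃ Fin m := C.equivFin
  let f : (C : Set ι) ↪ ι :=
    { toFun := fun i => if (i : ι) ∈ S then i else ν (idx i)
      inj' := by
        intro i j hij
        have hi : (i : ι) ∈ C := i.2
        have hj : (j : ι) ∈ C := j.2
        dsimp only at hij
        split_ifs at hij with h1 h2 h2
        · exact Subtype.ext hij
        · exact absurd (hij ▸ hi) (ν _).2
        · exact absurd (hij ▸ hj) (ν _).2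
        · exact idx.injective (Fin.ext (hν hij)) }
  obtain ⟨e, he⟩ := Cardinal.extend_function_of_lt f
    ((Cardinal.lt_aleph0_of_finite _).trans_le (Cardinal.aleph0_le_mk ι)) ⟨Equiv.refl ι⟩
  -- `p` is undefined at the first `m` members of the sequence `ν`, which contain the images of
  -- `A \ S`, and shifts the later ones down
  let p : ι → Option ι := fun i =>
    if h : ∃ n, (ν n : ι) = i then
      if h.choose < m then none else some (ν (h.choose - m))
    else some i
  have hpν : ∀ n, p (ν n) = if n < m then none else some ((ν (n - m) : ι)) := by
    intro n
    have h : ∃ n', (ν n' : ι) = ν n := ⟨n, rfl⟩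
    have h' : h.choose = n := hν h.choose_spec
    simp only [p, dif_pos h, h']
  have hp : ∀ i, (¬ ∃ n, (ν n : ι) = i) → p i = some i := fun i h => dif_neg h
  refine ⟨e, p, fun i hi => ?_, fun i hi => hp i ?_, fun i hi hiS => ?_, fun j => ?_⟩
  · have := he ⟨i, by simp [C, hi]⟩
    simpa [f, hi] using this
  · rintro ⟨n, rfl⟩
    exact (ν n).2 hi
  · have h1 : e i = f ⟨i, by simp [C, hi]⟩ := he ⟨i, by simp [C, hi]⟩
    have h2 : f ⟨i, by simp [C, hi]⟩ = ν (idx ⟨i, by simp [C, hi]⟩) := if_neg hiS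
    rw [h1, h2, hpν, if_pos (Fin.is_lt _)]
  · by_cases h : ∃ n, (ν n : ι) = j
    · obtain ⟨n, rfl⟩ := h
      exact ⟨ν (n + m), by rw [hpν, if_neg (by omega), Nat.add_sub_cancel]⟩
    · exact ⟨j, hp j h⟩

theorem map_mem_center_of_surjective {G H : Type*} [Group G] [Group H] {f : G →* H}
    (hf : Function.Surjective f) {g : G} (hg : g ∈ Subgroup.center G) :
    f g ∈ Subgroup.center H := by
  refine Subgroup.mem_center_iff.mpr fun h => ?_
  obtain ⟨h, rfl⟩ := hf h
  rw [← map_mul, ← map_mul, Subgroup.mem_center_iff.mp hg]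

/-- Let `x` be fixed modulo `K` by all automorphisms that fix finitely many given basis elements.
Then `x` lies modulo `K` in the subgroup generated by these: an automorphism moves the remaining
basis elements that occur in `x` to new ones, which a surjective endomorphism then sends to `1`. -/
theorem IsNilBasis.exists_mem_closure_of_fixed {G ι : Type*} [Group G] [Infinite ι] {k : ℕ}
    {b : ι → G} (hb : IsNilBasis k b) (S : Finset ι) (K : Subgroup G)
    (hK : ∀ f : G →* G, Function.Surjective f → ∀ g ∈ K, f g ∈ K) {x : G}
    (hx : ∀ σ : MulAut G, (∀ i ∈ S, σ (b i) = b i) → σ x * x⁻¹ ∈ K) :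
    ∃ y ∈ Subgroup.closure (b '' (S : Set ι)), y * x⁻¹ ∈ K := by
  classical
  obtain ⟨A, hA⟩ := hb.exists_finset_mem_closure x
  obtain ⟨e, p, he, hp, hpe, hsurj⟩ := exists_perm_and_partial_surjection S A
  obtain ⟨σ, hσ⟩ := hb.exists_perm_mulAut e
  obtain ⟨f, hf⟩ := hb.exists_hom hb.lcs_eq_bot fun i => (p i).elim 1 b
  have hfs : Function.Surjective f := fun g => by
    refine hb.range_le (φ := MonoidHom.id G) (S := f.range) (fun j => ?_) g
    obtain ⟨i, hi⟩ := hsurj j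
    exact ⟨b i, by simp [hf, hi]⟩
  have hfx : f x = x := by
    have : Subgroup.closure (b '' (A : Set ι)) ≤ f.eqLocus (MonoidHom.id G) := by
      rw [Subgroup.closure_le]
      rintro _ ⟨i, hi, rfl⟩
      have : p i = some i := hp i (Finset.mem_union_right _ hi)
      change f (b i) = b i
      rw [hf, this]
      rfl
    exact this hA
  refine ⟨f (σ x), ?_, ?_⟩
  · have : Subgroup.closure (b '' (A : Set ι)) ≤
        (Subgroup.closure (b '' (S : Set ι))).comap (f.comp σ.toMonoidHom) := by
      rw [Subgroup.closure_le]
      rintro _ ⟨i, hi, rfl⟩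
      change f (σ (b i)) ∈ Subgroup.closure (b '' (S : Set ι))
      rw [hσ, hf]
      by_cases hiS : i ∈ S
      · rw [he i hiS, hp i (Finset.mem_union_left _ hiS)]
        exact Subgroup.subset_closure ⟨i, hiS, rfl⟩
      · rw [hpe i hi hiS]
        exact Subgroup.one_mem _
    exact this hA
  · have := hK f hfs _ (hx σ fun i hi => by rw [hσ, he i hi])
    rwa [map_mul, map_inv, hfx] at this

end FixedElements

/-! ### Primitive pairs -/

section PrimitivePairs

variable {N ι : Type*} [Group N] [Infinite ι] {c : ℕ} {b : ι → N}

theorem mem_ker_conj_iff {x : N} :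
    x ∈ (MulAut.conj : N →* MulAut N).ker ↔ x ∈ Subgroup.center N := by
  rw [MonoidHom.mem_ker, Subgroup.mem_center_iff, MulEquiv.ext_iff]
  refine forall_congr' fun y => ?_
  rw [MulAut.conj_apply, MulAut.one_apply, mul_inv_eq_iff_eq_mul, eq_comm]

theorem conj_eq_conj_iff {x y : N} :
    MulAut.conj x = MulAut.conj y ↔ x⁻¹ * y ∈ Subgroup.center N := by
  rw [← inv_mul_eq_one, ← map_inv, ← map_mul, ← MonoidHom.mem_ker, mem_ker_conj_iff]

theorem mul_conj_mul_inv (σ : MulAut N) (x : N) :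
    σ * MulAut.conj x * σ⁻¹ = MulAut.conj (σ x) := by
  ext z
  simp [MulAut.mul_apply]

/-- In an infinitely generated free nilpotent group every primitive element belongs to an infinite
basis. -/
theorem exists_isNilBasis_of_isPrimitiveElement (hb : IsNilBasis c b) (hc : c ≠ 0) {x : N}
    (hx : IsPrimitiveElement c x) :
    ∃ B : Set N, Infinite B ∧ IsNilBasis c (Subtype.val : B → N) ∧ x ∈ B := by
  obtain ⟨B, hB, hxB⟩ := hx
  exact ⟨B, hb.infinite_of_infinite (isNilBasis_subtype_val.mpr hB) hc, hB, hxB⟩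

theorem IsNilBasis.eq_one_of_mem_center_of_fixed (hb : IsNilBasis c b) (hc : 2 ≤ c) (i : ι) {t : N}
    (ht : t ∈ Subgroup.center N) (hfix : ∀ σ ∈ autStabilizer (b i), σ t = t) : t = 1 := by
  classical
  obtain ⟨y, hy, hyt⟩ := hb.exists_mem_closure_of_fixed {i} ⊥
    (fun f _ g hg => by rw [Subgroup.mem_bot] at hg ⊢; rw [hg, map_one]) (x := t)
    (fun σ hσ => by rw [hfix σ (hσ i (by simp)), mul_inv_cancel]; exact one_mem _)
  rw [Subgroup.mem_bot, mul_inv_eq_one] at hyt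
  subst hyt
  rw [Finset.coe_singleton, Set.image_singleton, ← Subgroup.zpowers_eq_closure] at hy
  obtain ⟨n, rfl⟩ := hy
  obtain ⟨f, hf⟩ := hb.exists_coord (by omega) i
  have h1 := map_eq_one_of_mem_lcs_one f (hb.center_le_lcs_one hc ht)
  have h2 : n = 0 := by
    simp only [map_zpow, hf, if_true] at h1
    have := congrArg Multiplicative.toAdd h1
    simpa using this
  simp [h2]

theorem pairDetermines_pairOf (x : N) : PairDetermines (pairOf x) x := ⟨rfl, fun _ hσ => hσ⟩

theorem eq_of_pairDetermines_pairOf (hb : IsNilBasis c b) (hc : 2 ≤ c) {x y : N}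
    (hx : IsPrimitiveElement c x) (h : PairDetermines (pairOf x) y) : y = x := by
  obtain ⟨B, hB, hBb, hxB⟩ := exists_isNilBasis_of_isPrimitiveElement hb (by omega) hx
  have hcen : x⁻¹ * y ∈ Subgroup.center N := conj_eq_conj_iff.mp h.1.symm
  have := hBb.eq_one_of_mem_center_of_fixed hc ⟨x, hxB⟩ hcen fun σ hσ => by
    have h1 : σ x = x := hσ
    rw [map_mul, map_inv, h1, h.2 σ hσ]
  exact (inv_mul_eq_one.mp this).symm

theorem pairOf_injOn (hb : IsNilBasis c b) (hc : 2 ≤ c) :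
    Set.InjOn pairOf {x : N | IsPrimitiveElement c x} := by
  intro x hx y hy hxy
  exact eq_of_pairDetermines_pairOf hb hc hy (hxy ▸ pairDetermines_pairOf x)

theorem isPrimitivePair_pairOf {x : N} (hx : IsPrimitiveElement c x) :
    IsPrimitivePair c (pairOf x) := by
  refine ⟨⟨x, hx, rfl⟩, ⟨x, hx, rfl⟩, fun σ hσ => ?_⟩
  have hσ : σ x = x := hσ
  have := mul_conj_mul_inv σ x
  rw [hσ, mul_inv_eq_iff_eq_mul] at this
  exact this

theorem exists_eq_pairOf_of_isPrimitivePair (hb : IsNilBasis c b) (hc : 2 ≤ c)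
    {P : MulAut N × Set (MulAut N)} (hP : IsPrimitivePair c P) :
    ∃ x, IsPrimitiveElement c x ∧ P = pairOf x := by
  classical
  have hc0 : c ≠ 0 := by omega
  obtain ⟨τ, S⟩ := P
  obtain ⟨⟨x₀, hx₀, hτ⟩, ⟨z, hz, hS⟩, hcomm⟩ := hP
  dsimp only at hτ hS hcomm
  subst hτ hS
  obtain ⟨B, hB, hBb, hzB⟩ := exists_isNilBasis_of_isPrimitiveElement hb hc0 hz
  obtain ⟨B₀, hB₀, hBb₀, hxB₀⟩ := exists_isNilBasis_of_isPrimitiveElement hb hc0 hx₀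
  -- modulo the centre, `x₀` is a power of `z`
  obtain ⟨y, hy, hyx⟩ := hBb.exists_mem_closure_of_fixed {⟨z, hzB⟩} (Subgroup.center N)
    (fun f hf g hg => map_mem_center_of_surjective hf hg) (x := x₀) fun σ hσ => by
      have h1 : σ z = z := hσ ⟨z, hzB⟩ (by simp)
      have h2 := mul_conj_mul_inv σ x₀
      rw [hcomm σ h1, mul_inv_cancel_right, conj_eq_conj_iff] at h2
      have h3 := Subgroup.mem_center_iff.mp h2 x₀
      rw [mul_inv_cancel_left] at h3
      rwa [h3, mul_inv_cancel_right]
  rw [Finset.coe_singleton, Set.image_singleton, ← Subgroup.zpowers_eq_closure] at hy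
  obtain ⟨n, hn⟩ := hy
  have hn : z ^ n = y := hn
  -- the coordinate of `x₀` shows that the exponent is `1` or `-1`
  obtain ⟨f, hf⟩ := hBb₀.exists_coord hc0 ⟨x₀, hxB₀⟩
  have hfx : f x₀ = Multiplicative.ofAdd 1 := by simpa using hf ⟨x₀, hxB₀⟩
  have h1 := map_eq_one_of_mem_lcs_one f (hBb.center_le_lcs_one hc hyx)
  rw [map_mul, map_inv, mul_inv_eq_one, hfx, ← hn, map_zpow] at h1
  have h2 : n * (f z).toAdd = 1 := by simpa using congrArg Multiplicative.toAdd h1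
  have hτ : MulAut.conj x₀ = MulAut.conj (z ^ n) := by
    rw [eq_comm, conj_eq_conj_iff, hn]
    have h3 := inv_mem hyx
    have h4 := Subgroup.mem_center_iff.mp h3 y
    rw [mul_inv_rev, inv_inv] at h3 h4
    have h5 : y⁻¹ * x₀ = x₀ * y⁻¹ := by
      rw [inv_mul_eq_iff_eq_mul, h4, inv_mul_cancel_right]
    rwa [h5]
  rcases Int.eq_one_or_neg_one_of_mul_eq_one h2 with rfl | rfl
  · exact ⟨z, hz, by rw [hτ, zpow_one]; rfl⟩
  · refine ⟨z⁻¹, hz.inv hc0, Prod.ext (by rw [hτ, zpow_neg_one]; rfl) ?_⟩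
    ext σ
    simp [pairOf, autStabilizer]

theorem pairOf_apply (σ : MulAut N) (x : N) : pairOf (σ x) = conjPair σ (pairOf x) := by
  refine Prod.ext (mul_conj_mul_inv σ x).symm ?_
  ext ρ
  simp only [pairOf, conjPair, autStabilizer, Set.mem_image, Set.mem_ofPred_eq]
  constructor
  · intro h
    exact ⟨σ⁻¹ * ρ * σ, by simp [MulAut.mul_apply, h], by group⟩
  · rintro ⟨ρ, h, rfl⟩
    simp [MulAut.mul_apply, h]

end PrimitivePairs

/-! ### Independent conjugations -/

section IndependentPairs

variable {N ι : Type*} [Group N] {c : ℕ} {b : ι → N}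

/-- Representatives of the members of a basis of the inner automorphism group generate: modulo the
subgroup `H` they generate, the group is an image of its centre, so `H` contains all commutators,
hence the centre. -/
theorem IsNilBasis.lift_surjective_of_conj [Nontrivial ι] (hb : IsNilBasis c b) (hc : 2 ≤ c)
    {κ : Type*} {X : κ → (MulAut.conj : N →* MulAut N).range}
    (hX : Function.Surjective (FreeGroup.lift X)) {b' : κ → N}
    (hb' : ∀ l, MulAut.conj (b' l) = X l) : Function.Surjective (FreeGroup.lift b') := by
  rw [← MonoidHom.range_eq_top, eq_top_iff]
  have hq : MulAut.conj.rangeRestrict.comp (FreeGroup.lift b') = FreeGroup.lift X :=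
    FreeGroup.ext_hom _ _ fun l => Subtype.ext (by simpa using hb' l)
  have hdec : ∀ n : N, ∃ h ∈ (FreeGroup.lift b').range, ∃ s ∈ Subgroup.center N, n = h * s := by
    intro n
    obtain ⟨w, hw⟩ := hX (MulAut.conj.rangeRestrict n)
    rw [← hq] at hw
    exact ⟨_, ⟨w, rfl⟩, _, conj_eq_conj_iff.mp (congrArg Subtype.val hw), by simp⟩
  have hcomm : lcs N 1 ≤ (FreeGroup.lift b').range := by
    refine Subgroup.commutator_le.mpr fun p _ q _ => ?_
    obtain ⟨h, hh, s, hs, rfl⟩ := hdec p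
    obtain ⟨h', hh', s', hs', rfl⟩ := hdec q
    rw [commutatorElement_mul_left_of_mem_center
        (by rw [commutatorElement_eq_one_of_mem_center_left hs]; exact one_mem _),
      commutatorElement_eq_one_of_mem_center_left hs, mul_one,
      commutatorElement_mul_right_of_mem_center
        (by rw [commutatorElement_eq_one_of_mem_center_right hs']; exact one_mem _),
      commutatorElement_eq_one_of_mem_center_right hs', mul_one, commutatorElement_def]
    exact mul_mem (mul_mem (mul_mem hh hh') (inv_mem hh)) (inv_mem hh')
  intro n _
  obtain ⟨h, hh, s, hs, rfl⟩ := hdec n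
  exact mul_mem hh (hcomm (hb.center_le_lcs_one hc hs))

/-- Representatives of the members of a basis of the inner automorphism group form a basis. The
kernel of the resulting map `φ` from the free nilpotent group of class `c` is central and consists
of commutators; a section `s` of `φ` exists, and `s ∘ φ` is the identity modulo the centre, hence
the identity on commutators. -/
theorem IsNilBasis.of_conj [Nontrivial ι] (hb : IsNilBasis c b) (hc : 2 ≤ c)
    {κ : Type*} {X : κ → (MulAut.conj : N →* MulAut N).range} (hX : IsNilBasis (c - 1) X)
    {b' : κ → N} (hb' : ∀ l, MulAut.conj (b' l) = X l) : IsNilBasis c b' := by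
  have hsurj := hb.lift_surjective_of_conj hc hX.1 hb'
  refine ⟨hsurj, le_antisymm ?_ ?_⟩
  swap
  · intro w hw
    have := map_mem_lcs (FreeGroup.lift b') hw
    rwa [hb.lcs_eq_bot] at this
  have hq : MulAut.conj.rangeRestrict.comp (FreeGroup.lift b') = FreeGroup.lift X :=
    FreeGroup.ext_hom _ _ fun l => Subtype.ext (by simpa using hb' l)
  have hker : ∀ w, FreeGroup.lift b' w = 1 → w ∈ lcs (FreeGroup κ) (c - 1) := by
    intro w hw
    rw [← hX.2, MonoidHom.mem_ker, ← hq, MonoidHom.comp_apply, hw, map_one]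
  set Q := FreeGroup κ ⧸ lcs (FreeGroup κ) c
  set π : FreeGroup κ →* Q := QuotientGroup.mk' _
  have hQ : lcs Q c = ⊥ := lcs_quotient_eq_bot c
  choose v hv using fun i => hsurj (b i)
  obtain ⟨s, hs⟩ := hb.exists_hom hQ fun i => π (v i)
  have hcen : ∀ w ∈ lcs (FreeGroup κ) (c - 1), π w ∈ Subgroup.center Q := by
    intro w hw
    refine lcs_le_center (n := c - 1) ?_ (map_mem_lcs π hw)
    rw [Nat.sub_add_cancel (by omega)]
    exact hQ
  -- `s (φ p) = p` modulo the centre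
  have hmod : ∀ w, ∃ z ∈ Subgroup.center Q, s (FreeGroup.lift b' w) = π w * z := by
    intro w
    have hsec : ∀ n : N, ∃ w', FreeGroup.lift b' w' = n ∧ s n = π w' := by
      intro n
      obtain ⟨u, rfl⟩ := hb.1 n
      refine ⟨FreeGroup.lift v u, ?_, ?_⟩
      · have : (FreeGroup.lift b').comp (FreeGroup.lift v) = FreeGroup.lift b :=
          FreeGroup.ext_hom _ _ fun i => by simp [hv]
        exact DFunLike.congr_fun this u
      · have : s.comp (FreeGroup.lift b) = π.comp (FreeGroup.lift v) :=
          FreeGroup.ext_hom _ _ fun i => by simp [hs]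
        exact DFunLike.congr_fun this u
    obtain ⟨w', h1, h2⟩ := hsec (FreeGroup.lift b' w)
    refine ⟨π (w⁻¹ * w'), hcen _ (hker _ ?_), ?_⟩
    · rw [map_mul, map_inv, h1, inv_mul_cancel]
    · rw [h2, ← map_mul, mul_inv_cancel_left]
  have hid : ∀ w ∈ lcs (FreeGroup κ) 1, s (FreeGroup.lift b' w) = π w := by
    have : lcs (FreeGroup κ) 1 ≤ (s.comp (FreeGroup.lift b')).eqLocus π := by
      refine Subgroup.commutator_le.mpr fun p _ q _ => ?_
      obtain ⟨z, hz, hp⟩ := hmod p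
      obtain ⟨z', hz', hq⟩ := hmod q
      change s (FreeGroup.lift b' ⁅p, q⁆) = π ⁅p, q⁆
      rw [map_commutatorElement, map_commutatorElement, map_commutatorElement, hp, hq,
        commutatorElement_mul_left_of_mem_center
          (by rw [commutatorElement_eq_one_of_mem_center_left hz]; exact one_mem _),
        commutatorElement_eq_one_of_mem_center_left hz, mul_one,
        commutatorElement_mul_right_of_mem_center
          (by rw [commutatorElement_eq_one_of_mem_center_right hz']; exact one_mem _),
        commutatorElement_eq_one_of_mem_center_right hz', mul_one]
    exact fun w hw => this hw
  intro w hw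
  have h1 := hid w (Subgroup.lowerCentralSeries_antitone _ (by omega) (hker w hw))
  rw [MonoidHom.mem_ker.mp hw, map_one] at h1
  rw [← QuotientGroup.ker_mk' (lcs (FreeGroup κ) c)]
  exact h1.symm

/-- If the inner automorphism group is free nilpotent of class `c - 1`, the centre consists of
`c`-fold commutators. -/
theorem center_le_lcs_of_conj {κ : Type*} {X : κ → (MulAut.conj : N →* MulAut N).range}
    (hX : IsNilBasis (c - 1) X) {b' : κ → N} (hb' : ∀ l, MulAut.conj (b' l) = X l)
    (hsurj : Function.Surjective (FreeGroup.lift b')) : Subgroup.center N ≤ lcs N (c - 1) := by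
  have hq : MulAut.conj.rangeRestrict.comp (FreeGroup.lift b') = FreeGroup.lift X :=
    FreeGroup.ext_hom _ _ fun l => Subtype.ext (by simpa using hb' l)
  intro t ht
  obtain ⟨w, rfl⟩ := hsurj t
  refine map_mem_lcs _ ?_
  rw [← hX.2, MonoidHom.mem_ker, ← hq]
  exact Subtype.ext (mem_ker_conj_iff.mpr ht)

/-- Elements that induce independent conjugations belong to a common basis. -/
theorem exists_isNilBasis_of_independentConjugations [Nontrivial ι] (hb : IsNilBasis c b)
    (hc : 2 ≤ c) {x y : N}
    (h : IndependentConjugations c (MulAut.conj x) (MulAut.conj y)) :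
    Subgroup.center N ≤ lcs N (c - 1) ∧
      ∃ B : Set N, IsNilBasis c (Subtype.val : B → N) ∧ x ∈ B ∧ y ∈ B ∧ x ≠ y := by
  classical
  obtain ⟨hne, X, hX, ⟨ξ, hξ, hξx⟩, ⟨η, hη, hηy⟩⟩ := h
  choose r hr using fun l : X => l.1.2
  let b' : X → N := fun l =>
    if l.1.1 = MulAut.conj x then x else if l.1.1 = MulAut.conj y then y else r l
  have hb' : ∀ l : X, MulAut.conj (b' l) = l.1 := by
    intro l
    simp only [b']
    split_ifs with h1 h2
    · exact h1.symm
    · exact h2.symm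
    · exact hr l
  have hX' := isNilBasis_subtype_val.mpr hX
  have hbas := hb.of_conj hc hX' hb'
  refine ⟨center_le_lcs_of_conj hX' hb' hbas.1, Set.range b',
    isNilBasis_subtype_val.mpr (hbas.isFreeNilpotentBasis_range (by omega)), ⟨⟨ξ, hξ⟩, ?_⟩,
    ⟨⟨η, hη⟩, ?_⟩, fun h => hne (h ▸ rfl)⟩
  · simp only [b', hξx, if_true]
  · simp only [b', hηy, if_true, if_neg (Ne.symm hne)]

end IndependentPairs

/-! ### Operations given by central words -/

section Cocycles

/-- A symmetric cocycle with `T u u = 1` satisfies `T (u²) (v²) = (T u v)²`: both are obtained by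
bracketing a product of two factors `u` and two factors `v` in different ways. -/
theorem cocycle_sq {N A : Type*} [Group N] [CommGroup A] (T : N → N → A)
    (hself : ∀ u, T u u = 1) (hsymm : ∀ u v, T u v = T v u)
    (hcocycle : ∀ u v w, T u v * T (u * v) w = T v w * T u (v * w))
    (hcongr : ∀ u v v', v⁻¹ * v' ∈ lcs N 1 → T u v = T u v') (u v : N) :
    T (u * u) (v * v) = T u v ^ 2 := by
  have key : ∀ {G : Type _} [Group G] (p q r : G), (p * q * r)⁻¹ * (q * p * r) ∈ lcs G 1 := by
    intro G _ p q r
    have : (p * q * r)⁻¹ * (q * p * r) = ⁅r⁻¹ * q⁻¹ * r, r⁻¹ * p⁻¹ * r⁆ := by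
      simp only [commutatorElement_def]
      group
    rw [this]
    exact Subgroup.commutator_mem_commutator (Subgroup.mem_top _) (Subgroup.mem_top _)
  have h1 := hcocycle u u (v * v)
  have h2 := hcocycle u v (u * v)
  have h3 := hcocycle v v u
  have e1 : T u (u * (v * v)) = T u (v * (u * v)) := hcongr _ _ _ (by
    simpa only [mul_assoc] using key u v v)
  have e2 : T v (v * u) = T v (u * v) := hcongr _ _ _ (by simpa using key v u 1)
  rw [hself, one_mul] at h1 h3
  rw [hself, mul_one] at h2
  rw [hsymm (v * v), hsymm v u, e2] at h3
  rw [h1, h3, e1, mul_assoc, ← h2, sq]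

end Cocycles

section Words

open scoped IsMulCommutative

variable {N ι : Type*} [Group N] {c : ℕ} {b : ι → N}

theorem exists_mem_lcs_of_surjective {G H : Type*} [Group G] [Group H] {f : G →* H}
    (hf : Function.Surjective f) {n : ℕ} {h : H} (hh : h ∈ lcs H n) : ∃ g ∈ lcs G n, f g = h := by
  have e := Subgroup.map_lowerCentralSeries (⊤ : Subgroup G) f n
  rw [Subgroup.map_top_of_surjective _ hf] at e
  have h' : h ∈ (lcs G n).map f := e ▸ hh
  exact h'

theorem map_lift_pair (φ : N →* N) (u v : N) (w : FreeGroup (Fin 2)) :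
    φ (FreeGroup.lift ![u, v] w) = FreeGroup.lift ![φ u, φ v] w := by
  have : φ.comp (FreeGroup.lift ![u, v]) = FreeGroup.lift ![φ u, φ v] :=
    FreeGroup.ext_hom _ _ fun i => by fin_cases i <;> simp
  exact DFunLike.congr_fun this w

theorem lift_self_pair_eq_one {w : FreeGroup (Fin 2)} (hw : w ∈ lcs (FreeGroup (Fin 2)) 1) (u : N) :
    FreeGroup.lift ![u, u] w = 1 := by
  have : FreeGroup.lift ![u, u] =
      (zpowersHom N u).comp (FreeGroup.lift fun _ => Multiplicative.ofAdd 1) :=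
    FreeGroup.ext_hom _ _ fun i => by fin_cases i <;> simp
  rw [this, MonoidHom.comp_apply, map_eq_one_of_mem_lcs_one _ hw, map_one]

theorem lift_pair_congr {n : ℕ} (hN : lcs N (n + 1) = ⊥) {w : FreeGroup (Fin 2)}
    (hw : w ∈ lcs (FreeGroup (Fin 2)) n) {u v u' v' : N} (hu : u⁻¹ * u' ∈ lcs N 1)
    (hv : v⁻¹ * v' ∈ lcs N 1) : FreeGroup.lift ![u, v] w = FreeGroup.lift ![u', v'] w := by
  have := map_eq_pow_of_mem_lcs 1 n hN (FreeGroup.lift ![u', v']) (FreeGroup.lift ![u, v])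
    (inv_pow_mul_mem_lcs_one 1 _ _ fun i => by fin_cases i <;> simpa) hw
  simpa using this.symm

theorem lift_pair_sq {n : ℕ} (hN : lcs N (n + 1) = ⊥) {w : FreeGroup (Fin 2)}
    (hw : w ∈ lcs (FreeGroup (Fin 2)) n) (u v : N) :
    FreeGroup.lift ![u * u, v * v] w = FreeGroup.lift ![u, v] w ^ 2 ^ (n + 1) :=
  map_eq_pow_of_mem_lcs 2 n hN _ _
    (inv_pow_mul_mem_lcs_one 2 _ _ fun i => by
      fin_cases i <;> simp [sq, -mul_inv_rev, -Subgroup.lowerCentralSeries_succ]) hw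

/-- The retraction of a free group onto the free group on two of its generators. -/
def pairRetraction [DecidableEq ι] (i j : ι) : FreeGroup ι →* FreeGroup (Fin 2) :=
  FreeGroup.lift fun l => if l = i then FreeGroup.of 0 else if l = j then FreeGroup.of 1 else 1

theorem IsNilBasis.mem_lcs_of_lift_pair_eq_one (hb : IsNilBasis c b) {i j : ι} (hij : i ≠ j)
    {w : FreeGroup (Fin 2)} (hw : FreeGroup.lift ![b i, b j] w = 1) :
    w ∈ lcs (FreeGroup (Fin 2)) c := by
  classical
  have h1 : (FreeGroup.lift b).comp (FreeGroup.map ![i, j]) = FreeGroup.lift ![b i, b j] :=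
    FreeGroup.ext_hom _ _ fun l => by fin_cases l <;> simp
  have h2 : (pairRetraction i j).comp (FreeGroup.map ![i, j]) = MonoidHom.id _ :=
    FreeGroup.ext_hom _ _ fun l => by fin_cases l <;> simp [pairRetraction, hij.symm]
  have h3 : FreeGroup.map ![i, j] w ∈ (FreeGroup.lift b).ker := by
    rw [MonoidHom.mem_ker, ← hw, ← h1, MonoidHom.comp_apply]
  rw [hb.2] at h3
  have h4 := map_mem_lcs (pairRetraction i j) h3
  rwa [← MonoidHom.comp_apply, h2] at h4

/-- An element of `γ_{n+1}` that is fixed by all automorphisms fixing two basis elements is the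
value at these of a word in `γ_{n+1}`. -/
theorem IsNilBasis.exists_word_of_fixed [Infinite ι] (hb : IsNilBasis c b) {i j : ι} {n : ℕ}
    {t : N} (ht : t ∈ lcs N n)
    (hfix : ∀ σ : MulAut N, σ (b i) = b i → σ (b j) = b j → σ t = t) :
    ∃ w ∈ lcs (FreeGroup (Fin 2)) n, FreeGroup.lift ![b i, b j] w = t := by
  classical
  obtain ⟨y, hy, hyt⟩ := hb.exists_mem_closure_of_fixed {i, j} ⊥
    (fun f _ g hg => by rw [Subgroup.mem_bot] at hg ⊢; rw [hg, map_one]) (x := t)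
    (fun σ hσ => by
      rw [hfix σ (hσ i (by simp)) (hσ j (by simp)), mul_inv_cancel]; exact Subgroup.one_mem _)
  rw [Subgroup.mem_bot, mul_inv_eq_one] at hyt
  subst hyt
  obtain ⟨w, hw, hwy⟩ := exists_mem_lcs_of_surjective hb.1 ht
  refine ⟨pairRetraction i j w, map_mem_lcs _ hw, ?_⟩
  obtain ⟨ε, hε⟩ := hb.exists_hom hb.lcs_eq_bot fun l =>
    if l = i then b i else if l = j then b j else 1
  have h1 : (FreeGroup.lift ![b i, b j]).comp (pairRetraction i j) = ε.comp (FreeGroup.lift b) :=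
    FreeGroup.ext_hom _ _ fun l => by
      simp only [MonoidHom.comp_apply, pairRetraction, FreeGroup.lift_apply_of, hε]
      split_ifs <;> simp
  have h2 : Subgroup.closure (b '' (({i, j} : Finset ι) : Set ι)) ≤ ε.eqLocus (MonoidHom.id N) := by
    rw [Subgroup.closure_le]
    rintro _ ⟨l, hl, rfl⟩
    change ε (b l) = b l
    rw [hε]
    simp only [Finset.coe_insert, Finset.coe_singleton, Set.mem_insert_iff,
      Set.mem_singleton_iff] at hl
    split_ifs with h h'
    · rw [h]
    · rw [h']
    · tauto
  rw [← MonoidHom.comp_apply, h1, MonoidHom.comp_apply, hwy]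
  exact h2 hy

/-- The automorphism that multiplies one basis element by a central element. -/
theorem IsNilBasis.exists_central_mulAut [DecidableEq ι] [Nontrivial ι] (hb : IsNilBasis c b)
    (hc : 2 ≤ c) (i : ι) {t : N} (ht : t ∈ Subgroup.center N) :
    ∃ σ : MulAut N, σ (b i) = b i * t ∧ ∀ l, l ≠ i → σ (b l) = b l := by
  obtain ⟨s, hs⟩ := hb.exists_hom (H := Subgroup.center N) (lcs_eq_bot_of_commGroup (by omega))
    fun l => if l = i then ⟨t, ht⟩ else 1
  have hss : ∀ n, s (s n : N) = 1 := fun n =>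
    map_eq_one_of_mem_lcs_one s (hb.center_le_lcs_one hc (s n).2)
  have hcen : ∀ n m : N, m * s n = s n * m := fun n m => Subgroup.mem_center_iff.mp (s n).2 m
  refine ⟨{ toFun := fun n => n * s n, invFun := fun n => n * (s n)⁻¹, left_inv := fun n => ?_,
            right_inv := fun n => ?_, map_mul' := fun n m => ?_ }, ?_, fun l hl => ?_⟩
  · simp [hss]
  · simp [hss]
  · rw [map_mul, Subgroup.coe_mul, mul_assoc n, ← mul_assoc m, hcen n m]
    simp only [mul_assoc]
  · change b i * s (b i) = _
    rw [hs, if_pos rfl]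
  · change b l * s (b l) = _
    rw [hs, if_neg hl]
    simp

/-- Let `z = x y t` with `x, y` from a basis and `t` central and fixed by all automorphisms that
fix `x` and `y`. Transported by automorphisms, `(x, y) ↦ z` becomes an operation on the pairs of
independent primitive elements. If it is associative and satisfies `(x y x⁻¹) ∗ x = x ∗ y`, then
`t = 1`: as a word in `x` and `y`, `t` is a symmetric cocycle `T`, so `T (x², y²) = T (x, y)²`; but
`T (x², y²) = T (x, y) ^ 2 ^ c`, because `T` is a product of `c`-fold commutators. -/
theorem IsNilBasis.eq_mul_of_symm_of_assoc [Infinite ι] (hb : IsNilBasis c b) (hc : 2 ≤ c)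
    (hcen : Subgroup.center N ≤ lcs N (c - 1)) {i j : ι} (hij : i ≠ j) {z : N}
    (hz : (b i * b j)⁻¹ * z ∈ Subgroup.center N)
    (hfix : ∀ σ : MulAut N, σ (b i) = b i → σ (b j) = b j → σ z = z)
    (hsymm : ∀ g : MulAut N, g (b i) = b i * b j * (b i)⁻¹ → g (b j) = b i → g z = z)
    (hassoc : ∀ g h k : MulAut N, g (b i) = b j → h (b i) = z → h (b j) = g (b j) →
      k (b i) = b i → k (b j) = g z → h z = k z) : z = b i * b j := by
  classical
  have hc1 : c - 1 + 1 = c := by omega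
  have hN : lcs N (c - 1 + 1) = ⊥ := by rw [hc1]; exact hb.lcs_eq_bot
  have hle : lcs N (c - 1) ≤ lcs N 1 := Subgroup.lowerCentralSeries_antitone _ (by omega)
  obtain ⟨t, ht, rfl⟩ : ∃ t ∈ Subgroup.center N, z = b i * b j * t := ⟨_, hz, by group⟩
  obtain ⟨w, hw, rfl⟩ := hb.exists_word_of_fixed (i := i) (j := j) (hcen ht) fun σ hi hj => by
    have := hfix σ hi hj
    rwa [map_mul, map_mul, hi, hj, mul_right_inj] at this
  have hw1 : w ∈ lcs (FreeGroup (Fin 2)) 1 := Subgroup.lowerCentralSeries_antitone _ (by omega) hw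
  -- the word as a function `T` with central values
  let T : N → N → Subgroup.center N := fun u v =>
    ⟨FreeGroup.lift ![u, v] w, lcs_le_center hN (map_mem_lcs _ hw)⟩
  have hT1 : ∀ u v, (T u v : N) ∈ lcs N 1 := fun u v => hle (map_mem_lcs _ hw)
  have hTcen : ∀ u v m : N, m * T u v = T u v * m := fun u v m =>
    Subgroup.mem_center_iff.mp (T u v).2 m
  have hTmap : ∀ (φ : N →* N) (u v : N), φ (T u v) = T (φ u) (φ v) := fun φ u v =>
    map_lift_pair φ u v w
  have hTaut : ∀ (σ : MulAut N) (u v : N), σ (T u v) = T (σ u) (σ v) := fun σ u v =>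
    hTmap σ.toMonoidHom u v
  have hTcongr : ∀ {u v u' v' : N}, u⁻¹ * u' ∈ lcs N 1 → v⁻¹ * v' ∈ lcs N 1 → T u v = T u' v' :=
    fun hu hv => Subtype.ext (lift_pair_congr hN hw hu hv)
  have hone : ∀ u : N, u⁻¹ * u ∈ lcs N 1 := fun u => by
    rw [inv_mul_cancel]; exact Subgroup.one_mem _
  have hTself : ∀ u, T u u = 1 := fun u => Subtype.ext (lift_self_pair_eq_one hw1 u)
  change ∀ g : MulAut N, g (b i) = b i * b j * (b i)⁻¹ → g (b j) = b i →
    g (b i * b j * T (b i) (b j)) = b i * b j * T (b i) (b j) at hsymm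
  change ∀ g h k : MulAut N, g (b i) = b j → h (b i) = b i * b j * T (b i) (b j) →
    h (b j) = g (b j) → k (b i) = b i → k (b j) = g (b i * b j * T (b i) (b j)) →
      h (b i * b j * T (b i) (b j)) = k (b i * b j * T (b i) (b j)) at hassoc
  change (T (b i) (b j) : N) ∈ Subgroup.center N at ht
  change b i * b j * (T (b i) (b j) : N) = b i * b j
  -- symmetry
  have hTsymm : ∀ u v, T u v = T v u := by
    have h0 : T (b i) (b j) = T (b j) (b i) := by
      obtain ⟨σ, hσ⟩ := hb.exists_perm_mulAut (Equiv.swap i j)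
      have h1 : σ (b i) = b j := by simp [hσ]
      have h2 : σ (b j) = b i := by simp [hσ]
      have h3 := hsymm (MulAut.conj (b i) * σ)
        (by rw [MulAut.mul_apply, h1, MulAut.conj_apply])
        (by rw [MulAut.mul_apply, h2, MulAut.conj_apply, mul_inv_cancel_right])
      rw [map_mul, map_mul, hTaut, MulAut.mul_apply, MulAut.mul_apply, h1, h2, MulAut.conj_apply,
        MulAut.conj_apply, mul_inv_cancel_right, inv_mul_cancel_right, mul_right_inj] at h3
      rw [← Subtype.ext h3]
      refine hTcongr ?_ (hone _)
      have : (b i * b j * (b i)⁻¹)⁻¹ * b j = ⁅b i, (b j)⁻¹⁆ := by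
        rw [commutatorElement_def]; group
      rw [this]
      exact Subgroup.commutator_mem_commutator (Subgroup.mem_top _) (Subgroup.mem_top _)
    intro u v
    obtain ⟨φ, hφ⟩ := hb.exists_hom hb.lcs_eq_bot fun l => if l = i then u else v
    have hi : φ (b i) = u := by simp [hφ]
    have hj : φ (b j) = v := by simp [hφ, hij.symm]
    refine Subtype.ext ?_
    rw [← hi, ← hj, ← hTmap, ← hTmap, h0]
  -- associativity
  have hTcocycle : ∀ u v x, T u v * T (u * v) x = T v x * T u (v * x) := by
    obtain ⟨l, hl⟩ := Infinite.exists_notMem_finset ({i, j} : Finset ι)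
    simp only [Finset.mem_insert, Finset.mem_singleton, not_or] at hl
    obtain ⟨hli, hlj⟩ := hl
    have h0 : T (b i) (b j) * T (b i * b j) (b l) = T (b j) (b l) * T (b i) (b j * b l) := by
      obtain ⟨κ, hκi, hκ⟩ := hb.exists_central_mulAut hc i ht
      obtain ⟨ν, hνi, hν⟩ := hb.exists_transvection hij
      have hαi : (κ * ν) (b i) = b i * b j * T (b i) (b j) := by
        rw [MulAut.mul_apply, hνi, map_mul, hκi, hκ j hij.symm, mul_assoc, mul_assoc, hTcen]
      have hα : ∀ m, m ≠ i → (κ * ν) (b m) = b m := fun m hm => by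
        rw [MulAut.mul_apply, hν m hm, hκ m hm]
      obtain ⟨σ, hσ⟩ := hb.exists_perm_mulAut (Equiv.swap j l)
      obtain ⟨g, hg⟩ := hb.exists_perm_mulAut (Equiv.swap i j * Equiv.swap j l)
      have hgi : g (b i) = b j := by
        rw [hg, Equiv.Perm.mul_apply, Equiv.swap_apply_of_ne_of_ne hij (Ne.symm hli),
          Equiv.swap_apply_left]
      have hgj : g (b j) = b l := by
        rw [hg, Equiv.Perm.mul_apply, Equiv.swap_apply_left,
          Equiv.swap_apply_of_ne_of_ne hli hlj]
      have hgl : g (b l) = b i := by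
        rw [hg, Equiv.Perm.mul_apply, Equiv.swap_apply_right, Equiv.swap_apply_right]
      have hgl' : g⁻¹ (b i) = b l := by rw [← hgl, MulAut.inv_apply_self]
      have hgi' : g⁻¹ (b j) = b i := by rw [← hgi, MulAut.inv_apply_self]
      have hhi : (κ * ν * σ) (b i) = b i * b j * T (b i) (b j) := by
        rw [MulAut.mul_apply, hσ, Equiv.swap_apply_of_ne_of_ne hij (Ne.symm hli), hαi]
      have hhj : (κ * ν * σ) (b j) = b l := by
        rw [MulAut.mul_apply, hσ, Equiv.swap_apply_left, hα l hli]
      have hki : (g * (κ * ν) * g⁻¹) (b i) = b i := by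
        rw [MulAut.mul_apply, hgl', MulAut.mul_apply, hα l hli, hgl]
      have hkj : (g * (κ * ν) * g⁻¹) (b j) = g (b i * b j * T (b i) (b j)) := by
        rw [MulAut.mul_apply, hgi', MulAut.mul_apply, hαi]
      have h1 := hassoc g (κ * ν * σ) (g * (κ * ν) * g⁻¹) hgi hhi (hhj.trans hgj.symm) hki hkj
      have hgz : g (b i * b j * T (b i) (b j)) = b j * b l * T (b j) (b l) := by
        rw [map_mul, map_mul, hTaut, hgi, hgj]
      rw [map_mul, map_mul, hTaut, hhi, hhj, map_mul, map_mul, hTaut, hki, hkj, hgz] at h1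
      have e1 : T (b i * b j * T (b i) (b j)) (b l) = T (b i * b j) (b l) :=
        hTcongr (by
          rw [mul_inv_rev, mul_assoc, inv_mul_cancel, mul_one]
          exact inv_mem (hT1 _ _)) (hone _)
      have e2 : T (b i) (b j * b l * T (b j) (b l)) = T (b i) (b j * b l) :=
        hTcongr (hone _) (by
          rw [mul_inv_rev, mul_assoc, inv_mul_cancel, mul_one]
          exact inv_mem (hT1 _ _))
      rw [e1, e2, mul_assoc (b i * b j), ← hTcen (b i) (b j) (b l)] at h1
      refine Subtype.ext ?_
      rw [Subgroup.coe_mul, Subgroup.coe_mul]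
      simpa only [mul_assoc, mul_right_inj] using h1
    intro u v x
    obtain ⟨φ, hφ⟩ := hb.exists_hom hb.lcs_eq_bot fun m =>
      if m = i then u else if m = j then v else x
    have hi : φ (b i) = u := by simp [hφ]
    have hj : φ (b j) = v := by simp [hφ, hij.symm]
    have hl : φ (b l) = x := by simp [hφ, hli, hlj]
    refine Subtype.ext ?_
    rw [← hi, ← hj, ← hl, Subgroup.coe_mul, Subgroup.coe_mul, ← map_mul φ, ← map_mul φ, ← hTmap,
      ← hTmap, ← hTmap, ← hTmap, ← map_mul φ, ← map_mul φ, ← Subgroup.coe_mul, ← Subgroup.coe_mul,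
      h0]
  -- the two values of `T (x², y²)`
  have hsq := cocycle_sq T hTself hTsymm hTcocycle (fun u v v' h => hTcongr (hone _) h) (b i) (b j)
  have hsq' : FreeGroup.lift ![b i, b j] w ^ 2 ^ c = FreeGroup.lift ![b i, b j] w ^ 2 := by
    have h1 := lift_pair_sq hN hw (b i) (b j)
    rw [hc1] at h1
    rw [← h1]
    exact congrArg Subtype.val hsq
  have hlt : 2 < 2 ^ c := lt_of_lt_of_le (by norm_num) (Nat.pow_le_pow_right two_pos hc)
  have htor : FreeGroup.lift ![b i, b j] (w ^ (2 ^ c - 2)) = 1 := by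
    rw [map_pow, pow_sub _ hlt.le, hsq', mul_inv_cancel]
  have hwc := mem_lcs_of_pow_mem c w (2 ^ c - 2) (by omega)
    (hb.mem_lcs_of_lift_pair_eq_one hij htor)
  have h1 : FreeGroup.lift ![b i, b j] w ∈ lcs N c := map_mem_lcs _ hwc
  rw [hb.lcs_eq_bot, Subgroup.mem_bot] at h1
  exact mul_eq_left.mpr h1

end Words

/-! ### The defining formula -/

section Formulas

namespace SOFormula

/-- Implication. -/
def imp (φ ψ : SOFormula) : SOFormula := .not (.and φ (.not ψ))

/-- Existential quantification over individuals. -/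
def ex (i : ℕ) (φ : SOFormula) : SOFormula := .not (.all i (.not φ))

/-- The value of `t` belongs to the `i`-th unary relation. -/
def mem (t : GroupTerm) (i : ℕ) : SOFormula := .rel 1 i fun _ => t

/-- The term `g t g⁻¹`. -/
def conjTerm (g t : GroupTerm) : GroupTerm := .mul (.mul g t) (.inv g)

/-- The `i`-th pair conjugated by `g` equals the `j`-th pair conjugated by `h`. The variable with
index `3` is bound and must not occur in `g` and `h`. -/
def conjPairEq (g : GroupTerm) (i : ℕ) (h : GroupTerm) (j : ℕ) : SOFormula :=
  .and (.eq (conjTerm g (.var i)) (conjTerm h (.var j)))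
    (.all 3 (.and
      (imp (mem (conjTerm (.inv g) (.var 3)) i) (mem (conjTerm (.inv h) (.var 3)) j))
      (imp (mem (conjTerm (.inv h) (.var 3)) j) (mem (conjTerm (.inv g) (.var 3)) i))))

/-- The pair with index `0` is fixed by everything that fixes the pairs with indices `1`, `2`. -/
def fixFormula : SOFormula :=
  .all 4 (imp (.and (conjPairEq (.var 4) 1 .one 1) (conjPairEq (.var 4) 2 .one 2))
    (conjPairEq (.var 4) 0 .one 0))

/-- The identity `(x y x⁻¹) ∗ x = x ∗ y` for the operation `x ∗ y = z`, where `x, y, z` are given by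
the pairs with indices `1, 2, 0`. -/
def symmFormula : SOFormula :=
  .all 4 (imp (.and (conjPairEq (.var 4) 1 (.var 1) 2) (conjPairEq (.var 4) 2 .one 1))
    (conjPairEq (.var 4) 0 .one 0))

/-- Associativity `(x ∗ y) ∗ u = x ∗ (y ∗ u)` for the operation `x ∗ y = z`, where `x, y, z` are
given by the pairs with indices `1, 2, 0`. Here the variables `4, 5, 6` stand for automorphisms
`g : (x, y) ↦ (y, u)`, `h : (x, y) ↦ (x ∗ y, u)` and `k : (x, y) ↦ (x, y ∗ u)`. -/
def assocFormula : SOFormula :=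
  .all 4 (.all 5 (.all 6 (imp
    (.and (conjPairEq (.var 4) 1 .one 2) (.and (conjPairEq (.var 5) 1 .one 0)
      (.and (conjPairEq (.var 5) 2 (.var 4) 2) (.and (conjPairEq (.var 6) 1 .one 1)
        (conjPairEq (.var 6) 2 (.var 4) 0)))))
    (conjPairEq (.var 5) 0 (.var 6) 0))))

/-- The formula that defines the pair of `x y` from the pairs of `x` and `y`. -/
def productFormula : SOFormula :=
  .and (.eq (.var 0) (.mul (.var 1) (.var 2)))
    (.and (ex 4 (conjPairEq .one 0 (.var 4) 1)) (.and fixFormula (.and symmFormula assocFormula)))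

end SOFormula

/-- The pair formed by the values of the `i`-th individual and the `i`-th unary relation
variable. -/
def SOAssignment.pair {G : Type*} (a : SOAssignment G) (i : ℕ) : G × Set G :=
  (a.elem i, {g | (fun _ => g) ∈ a.relation 1 i})

theorem SOAssignment.hasPair_iff {G : Type*} {a : SOAssignment G} {i : ℕ} {P : G × Set G} :
    a.HasPair i P ↔ a.pair i = P := by
  have h : ∀ v : Fin 1 → G, v = fun _ => v 0 := fun v => by
    funext j
    rw [Subsingleton.elim j 0]
  constructor
  · rintro ⟨h1, h2⟩
    refine Prod.ext h1 ?_
    ext g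
    simp [SOAssignment.pair, h2]
  · rintro rfl
    refine ⟨rfl, ?_⟩
    ext v
    simp only [SOAssignment.pair, Set.mem_ofPred_eq]
    rw [← h v]

theorem SOAssignment.pair_setElem {G : Type*} (a : SOAssignment G) {i k : ℕ} (h : i ≠ k) (g : G) :
    (a.setElem k g).pair i = a.pair i := by
  simp [SOAssignment.pair, SOAssignment.setElem, h]

theorem SOAssignment.elem_setElem_self {G : Type*} (a : SOAssignment G) (k : ℕ) (g : G) :
    (a.setElem k g).elem k = g := by
  simp [SOAssignment.setElem]

variable {N ι : Type*} [Group N] {c : ℕ} {b : ι → N}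

theorem SOFormula.holds_imp {G : Type*} [Group G] {φ ψ : SOFormula} {a : SOAssignment G} :
    (φ.imp ψ).Holds a ↔ (φ.Holds a → ψ.Holds a) := by
  simp [imp, Holds]

theorem SOFormula.holds_ex {G : Type*} [Group G] {φ : SOFormula} {i : ℕ} {a : SOAssignment G} :
    (φ.ex i).Holds a ↔ ∃ g, φ.Holds (a.setElem i g) := by
  simp [ex, Holds]

theorem SOFormula.holds_conjPairEq {g h : GroupTerm} {i j : ℕ}
    {a : SOAssignment (MulAut N)} (hg : ∀ s, g.eval (a.setElem 3 s) = g.eval a)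
    (hh : ∀ s, h.eval (a.setElem 3 s) = h.eval a) :
    (conjPairEq g i h j).Holds a ↔
      conjPair (g.eval a) (a.pair i) = conjPair (h.eval a) (a.pair j) := by
  have key : ∀ (γ ρ : MulAut N) (S : Set (MulAut N)),
      ρ ∈ (fun σ => γ * σ * γ⁻¹) '' S ↔ γ⁻¹ * ρ * γ ∈ S := by
    intro γ ρ S
    constructor
    · rintro ⟨σ, hσ, rfl⟩
      simpa [mul_assoc] using hσ
    · intro h
      exact ⟨_, h, by group⟩
  simp only [conjPairEq, Holds, holds_imp, mem, conjTerm, GroupTerm.eval, hg, hh,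
    SOAssignment.elem_setElem_self, conjPair, Prod.mk.injEq, SOAssignment.pair, Set.ext_iff, key,
    inv_inv, Set.mem_ofPred_eq]
  exact and_congr_right fun _ => forall_congr' fun _ => iff_def.symm

/-- For pairs that belong to primitive elements, `conjPairEq` expresses an equality of elements. -/
theorem SOFormula.holds_conjPairEq_iff [Infinite ι] (hb : IsNilBasis c b) (hc : 2 ≤ c)
    {g h : GroupTerm} {i j : ℕ} {a : SOAssignment (MulAut N)}
    (hg : ∀ s, g.eval (a.setElem 3 s) = g.eval a) (hh : ∀ s, h.eval (a.setElem 3 s) = h.eval a)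
    {p q : N} (hp : IsPrimitiveElement c p) (hq : IsPrimitiveElement c q)
    (hi : a.pair i = pairOf p) (hj : a.pair j = pairOf q) :
    (conjPairEq g i h j).Holds a ↔ g.eval a p = h.eval a q := by
  rw [holds_conjPairEq hg hh, hi, hj, ← pairOf_apply, ← pairOf_apply]
  exact (pairOf_injOn hb hc).eq_iff (hp.map_mulAut (by omega) _) (hq.map_mulAut (by omega) _)

section Semantics

variable [Infinite ι] (hb : IsNilBasis c b) (hc : 2 ≤ c) {a : SOAssignment (MulAut N)} {x y z : N}
  (hx : IsPrimitiveElement c x) (hy : IsPrimitiveElement c y) (hz : IsPrimitiveElement c z)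
  (h0 : a.pair 0 = pairOf z) (h1 : a.pair 1 = pairOf x) (h2 : a.pair 2 = pairOf y)

include hb hc hx hy hz h0 h1 h2

theorem SOFormula.holds_fixFormula :
    fixFormula.Holds a ↔ ∀ g : MulAut N, g x = x → g y = y → g z = z := by
  refine forall_congr' fun g => ?_
  have e0 := (a.pair_setElem (by decide : 0 ≠ 4) g).trans h0
  have e1 := (a.pair_setElem (by decide : 1 ≠ 4) g).trans h1
  have e2 := (a.pair_setElem (by decide : 2 ≠ 4) g).trans h2
  rw [holds_imp, Holds, holds_conjPairEq_iff hb hc (fun _ => rfl) (fun _ => rfl) hx hx e1 e1,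
    holds_conjPairEq_iff hb hc (fun _ => rfl) (fun _ => rfl) hy hy e2 e2,
    holds_conjPairEq_iff hb hc (fun _ => rfl) (fun _ => rfl) hz hz e0 e0, and_imp]
  rfl

theorem SOFormula.holds_symmFormula :
    symmFormula.Holds a ↔ ∀ g : MulAut N, g x = x * y * x⁻¹ → g y = x → g z = z := by
  refine forall_congr' fun g => ?_
  have e0 := (a.pair_setElem (by decide : 0 ≠ 4) g).trans h0
  have e1 := (a.pair_setElem (by decide : 1 ≠ 4) g).trans h1
  have e2 := (a.pair_setElem (by decide : 2 ≠ 4) g).trans h2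
  have e3 : (GroupTerm.var 1).eval (a.setElem 4 g) = MulAut.conj x := congrArg Prod.fst h1
  rw [holds_imp, Holds, holds_conjPairEq_iff hb hc (fun _ => rfl) (fun _ => rfl) hx hy e1 e2,
    holds_conjPairEq_iff hb hc (fun _ => rfl) (fun _ => rfl) hy hx e2 e1,
    holds_conjPairEq_iff hb hc (fun _ => rfl) (fun _ => rfl) hz hz e0 e0, and_imp, e3]
  rfl

theorem SOFormula.holds_assocFormula :
    assocFormula.Holds a ↔ ∀ g h k : MulAut N, g x = y → h x = z → h y = g y → k x = x →
      k y = g z → h z = k z := by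
  refine forall_congr' fun g => forall_congr' fun h => forall_congr' fun k => ?_
  have e : ∀ i, i ≠ 4 → i ≠ 5 → i ≠ 6 →
      (((a.setElem 4 g).setElem 5 h).setElem 6 k).pair i = a.pair i := fun i h4 h5 h6 => by
    rw [SOAssignment.pair_setElem _ h6, SOAssignment.pair_setElem _ h5,
      SOAssignment.pair_setElem _ h4]
  have e0 := (e 0 (by decide) (by decide) (by decide)).trans h0
  have e1 := (e 1 (by decide) (by decide) (by decide)).trans h1
  have e2 := (e 2 (by decide) (by decide) (by decide)).trans h2
  rw [holds_imp, Holds, Holds, Holds, Holds,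
    holds_conjPairEq_iff hb hc (fun _ => rfl) (fun _ => rfl) hx hy e1 e2,
    holds_conjPairEq_iff hb hc (fun _ => rfl) (fun _ => rfl) hx hz e1 e0,
    holds_conjPairEq_iff hb hc (fun _ => rfl) (fun _ => rfl) hy hy e2 e2,
    holds_conjPairEq_iff hb hc (fun _ => rfl) (fun _ => rfl) hx hx e1 e1,
    holds_conjPairEq_iff hb hc (fun _ => rfl) (fun _ => rfl) hy hz e2 e0,
    holds_conjPairEq_iff hb hc (fun _ => rfl) (fun _ => rfl) hz hz e0 e0,
    and_imp, and_imp, and_imp, and_imp]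
  rfl

end Semantics

theorem SOFormula.definesPair_productFormula [Infinite ι] (hb : IsNilBasis c b) (hc : 2 ≤ c)
    (hcen : Subgroup.center N ≤ lcs N (c - 1)) {i j : ι} (hij : i ≠ j) :
    productFormula.DefinesPair (pairOf (b i * b j)) (pairOf (b i)) (pairOf (b j)) := by
  classical
  have hc0 : c ≠ 0 := by omega
  have hx := hb.isPrimitiveElement hc0 i
  have hy := hb.isPrimitiveElement hc0 j
  intro a h1 h2
  rw [SOAssignment.hasPair_iff] at h1 h2 ⊢
  have e1 : a.elem 1 = MulAut.conj (b i) := congrArg Prod.fst h1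
  have e2 : a.elem 2 = MulAut.conj (b j) := congrArg Prod.fst h2
  have hex : (ex 4 (conjPairEq .one 0 (.var 4) 1)).Holds a ↔
      ∃ ρ : MulAut N, a.pair 0 = pairOf (ρ (b i)) := by
    rw [holds_ex]
    refine exists_congr fun ρ => ?_
    rw [holds_conjPairEq (fun _ => rfl) (fun _ => rfl), a.pair_setElem (by decide),
      a.pair_setElem (by decide), h1, ← pairOf_apply]
    simp [conjPair, GroupTerm.eval, SOAssignment.elem_setElem_self]
  constructor
  · rintro ⟨h3, h4, h5, h6, h7⟩
    obtain ⟨ρ, h0⟩ := hex.mp h4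
    have hz := hx.map_mulAut hc0 ρ
    rw [holds_fixFormula hb hc hx hy hz h0 h1 h2] at h5
    rw [holds_symmFormula hb hc hx hy hz h0 h1 h2] at h6
    rw [holds_assocFormula hb hc hx hy hz h0 h1 h2] at h7
    have h8 : MulAut.conj (b i * b j) = MulAut.conj (ρ (b i)) := by
      have e0 : a.elem 0 = MulAut.conj (ρ (b i)) := congrArg Prod.fst h0
      rw [map_mul, ← e0, ← e1, ← e2]
      exact h3.symm
    rw [h0, hb.eq_mul_of_symm_of_assoc hc hcen hij (conj_eq_conj_iff.mp h8) h5 h6 h7]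
  · intro h0
    obtain ⟨ρ, hρ, -⟩ := hb.exists_transvection hij
    have hz : IsPrimitiveElement c (b i * b j) := hρ ▸ hx.map_mulAut hc0 ρ
    have e0 : a.elem 0 = MulAut.conj (b i * b j) := congrArg Prod.fst h0
    refine ⟨?_, hex.mpr ⟨ρ, by rw [h0, hρ]⟩,
      (holds_fixFormula hb hc hx hy hz h0 h1 h2).mpr fun g hg hg' => by rw [map_mul, hg, hg'],
      (holds_symmFormula hb hc hx hy hz h0 h1 h2).mpr fun g hg hg' => by
        rw [map_mul, hg, hg', inv_mul_cancel_right],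
      (holds_assocFormula hb hc hx hy hz h0 h1 h2).mpr fun g h k hg hh hh' hk hk' => by
        rw [map_mul, hh, hh', map_mul, hk, hk', map_mul, hg, mul_assoc]⟩
    change a.elem 0 = a.elem 1 * a.elem 2
    rw [e0, e1, e2, map_mul]

end Formulas

theorem mainTheorem7 {N : Type*} [Group N] (c : ℕ) (hc : 2 ≤ c)
    (hN : IsInfinitelyGeneratedFreeNilpotent c N) :
    -- every primitive pair determines exactly one element
    (∀ P : MulAut N × Set (MulAut N), IsPrimitivePair c P → ∃! x : N, PairDetermines P x) ∧
    -- `x ↦ (τ_x, Γ_(x))` is an equivariant bijection from primitive elements to primitive pairs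
    Set.BijOn pairOf {x : N | IsPrimitiveElement c x} {P | IsPrimitivePair c P} ∧
    (∀ (σ : MulAut N) (x : N), pairOf (σ x) = conjPair σ (pairOf x)) ∧
    -- multiplication of independent primitive elements is definable in `Aut N`
    ∃ φ : SOFormula, ∀ P₁ P₂ : MulAut N × Set (MulAut N),
      IsPrimitivePair c P₁ → IsPrimitivePair c P₂ → IndependentConjugations c P₁.1 P₂.1 →
      ∀ x y : N, PairDetermines P₁ x → PairDetermines P₂ y →
        IsPrimitiveElement c (x * y) ∧
        IsPrimitivePair c (P₁.1 * P₂.1, autStabilizer (x * y)) ∧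
        PairDetermines (P₁.1 * P₂.1, autStabilizer (x * y)) (x * y) ∧
        φ.DefinesPair (P₁.1 * P₂.1, autStabilizer (x * y)) P₁ P₂ := by
  classical
  obtain ⟨B, hBinf, hBb⟩ := hN
  have hb := isNilBasis_subtype_val.mpr hBb
  have := hBinf.to_subtype
  refine ⟨fun P hP => ?_, ⟨fun x hx => isPrimitivePair_pairOf hx, pairOf_injOn hb hc,
    fun P hP => ?_⟩, pairOf_apply, SOFormula.productFormula, ?_⟩
  · obtain ⟨x, hx, rfl⟩ := exists_eq_pairOf_of_isPrimitivePair hb hc hP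
    exact ⟨x, pairDetermines_pairOf x, fun y hy => eq_of_pairDetermines_pairOf hb hc hx hy⟩
  · obtain ⟨x, hx, rfl⟩ := exists_eq_pairOf_of_isPrimitivePair hb hc hP
    exact ⟨x, hx, rfl⟩
  · intro P₁ P₂ hP₁ hP₂ hind x y hPx hPy
    obtain ⟨x', hx, rfl⟩ := exists_eq_pairOf_of_isPrimitivePair hb hc hP₁
    obtain ⟨y', hy, rfl⟩ := exists_eq_pairOf_of_isPrimitivePair hb hc hP₂
    obtain rfl := eq_of_pairDetermines_pairOf hb hc hx hPx
    obtain rfl := eq_of_pairDetermines_pairOf hb hc hy hPy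
    obtain ⟨hcen, C, hC, hxC, hyC, hne⟩ :=
      exists_isNilBasis_of_independentConjugations hb hc hind
    have := hb.infinite_of_infinite hC (by omega)
    have hij : (⟨x, hxC⟩ : C) ≠ ⟨y, hyC⟩ := fun h => hne (congrArg Subtype.val h)
    obtain ⟨ρ, hρ, -⟩ := hC.exists_transvection hij
    have hρ : ρ x = x * y := hρ
    have hxy : IsPrimitiveElement c (x * y) := hρ ▸ hx.map_mulAut (by omega) ρ
    have hpair : ((pairOf x).1 * (pairOf y).1, autStabilizer (x * y)) = pairOf (x * y) :=
      Prod.ext (map_mul MulAut.conj x y).symm rfl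
    rw [hpair]
    exact ⟨hxy, isPrimitivePair_pairOf hxy, pairDetermines_pairOf _,
      SOFormula.definesPair_productFormula hC hc hcen hij⟩
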